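/- Let $q$ be a prime power and $\alpha=0.08$. For $n\ge 0$ even let $X=X^{(n)}=(X_i)_{i\ge 0}$ denote a time-homogeneous Markov chain on $\{0,1,\dots,n\}$ with transition matrix \[P_n(d,r)=\mathbf 1(d+r\le n)\,q^{-(n-d-r)(n-r)}\,\frac{(q^{-(n-d)};q)_r\,(q^{-n};q)_r}{(q^{-r};q)_r},\qquad (x;q)_r=\prod_{i=0}^{r-1}(1-xq^i)\] (the transition matrix of the rank increments of random block bidiagonal matrices over $\mathbb F_q$ with uniform $n\times n$ blocks), and put \[Y_t=Y^{(n)}_t=X_{2\lfloor q^{n/2}(q-1)t\rfloor}-\tfrac n2\qquad(t\ge 0).\] Let $Z=(Z_t)_{t\ge0}$ be the right-continuous, non-explosive continuous-time Markov chain on $\mathbb Z$ which jumps from $b$ to $b+1$ at rate $q^{-b}$ and from $b$ to $b-1$ at rate $q^{b}$. Let $R_0=0$, $R_i=\inf\{t>R_{i-1}: Y_t\ne Y_{R_{i-1}}\}$ and $T_0=0$, $T_i=\inf\{t>T_{i-1}: Z_t\ne Z_{T_{i-1}}\}$ be the jump times of $Y$ and $Z$, and let $\widehat Y_i=Y_{R_i}$,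 $\widehat Z_i=Z_{T_i}$. Theorem. There is a constant $C$, depending only on $q$, such that for every even $n$ and every integer $a$ with $|a|\le 2\alpha n$ there is a coupling of the processes $Y^{(n)}$ and $Z$ with $Y^{(n)}_0=Z_0=a$ such that, with probability at least $1-Cq^{-2\alpha n}$, all of the following hold: (a) for all integers $0\le i\le q^{2\alpha n}$, $R_i$ and $T_i$ are finite and $\widehat Y_i=\widehat Z_i$; (b) for all integers $0\le i\le q^{2\alpha n}$, $|R_i-T_i|\le q^{-\alpha n}$; (c) $T_{\lfloor q^{2\alpha n}\rfloor}\ge q^{\alpha n}$. -/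

import Mathlib

open MeasureTheory Filter Topology Set
open scoped NNReal ENNReal

noncomputable section

namespace RankCoupling

/-- The `q`-Pochhammer symbol `(a; q)_r = ∏_{i < r} (1 - a q ^ i)`. -/
def qPochhammer (a q : ℝ) (r : ℕ) : ℝ :=
  ∏ i ∈ Finset.range r, (1 - a * q ^ i)

/-- The transition probabilities `P_n(d, r)` of the rank-increment chain on `{0, …, n}`:
`𝟙(d + r ≤ n) q^{-(n-d-r)(n-r)} (q^{-(n-d)}; q)_r (q^{-n}; q)_r / (q^{-r}; q)_r`. -/
def rankTransition (q : ℝ) (n : ℕ) (d r : Fin (n + 1)) : ℝ :=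
  if (d : ℕ) + (r : ℕ) ≤ n then
    q ^ (-(((n : ℤ) - d - r) * ((n : ℤ) - r)))
      * (qPochhammer (q ^ (-((n : ℤ) - d))) q r * qPochhammer (q ^ (-(n : ℤ))) q r)
      / qPochhammer (q ^ (-((r : ℕ) : ℤ))) q r
  else 0

/-- `X` is a time-homogeneous discrete time Markov chain with transition matrix `P`
(and arbitrary initial distribution) under `μ`. -/
structure IsMarkovChain {Ω S : Type*} [MeasurableSpace Ω] [MeasurableSpace S]
    (P : S → S → ℝ) (X : ℕ → Ω → S) (μ : Measure Ω) : Prop where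
  measurable : ∀ i, Measurable (X i)
  transition : ∀ (k : ℕ) (x : ℕ → S),
    μ.real {ω | ∀ i ≤ k + 1, X i ω = x i}
      = μ.real {ω | ∀ i ≤ k, X i ω = x i} * P (x k) (x (k + 1))

/-- The jump times of a path `z`: `T_0 = 0` and `T_{i+1} = inf {u > T_i : z_u ≠ z_{T_i}}`,
where the infimum of the empty set is `∞` (so that `T_{i+1} = ∞` if `T_i = ∞`). -/
def jumpTime {S : Type*} (z : ℝ≥0 → S) : ℕ → ℝ≥0∞
  | 0 => 0
  | i + 1 => ⨅ (u : ℝ≥0) (_ : jumpTime z i < (u : ℝ≥0∞) ∧ z u ≠ z (jumpTime z i).toNNReal),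
      (u : ℝ≥0∞)

/-- The embedded chain `z_{T_i}` of a path (meaningful when `T_i < ∞`). -/
def embeddedChain {S : Type*} (z : ℝ≥0 → S) (i : ℕ) : S :=
  z (jumpTime z i).toNNReal

/-- The transition matrix of the embedded chain of a rate matrix `Q`. -/
def jumpMatrix {S : Type*} [DecidableEq S] (Q : S → S → ℝ) (x y : S) : ℝ :=
  if y = x then 0 else Q x y / (-Q x x)

/-- `Z` is a (non-explosive, right-continuous) continuous time Markov chain on the countable set `S`
with transition rate matrix `Q` (with no absorbing state, i.e. `-Q x x > 0` for all `x`) and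
arbitrary initial distribution, in the usual jump chain / holding time description: given the past,
the chain waits in its current state `x` for an exponential time with parameter `-Q x x` and
then, independently of this time, it jumps to `y ≠ x` with probability `Q x y / (-Q x x)`. -/
structure IsContinuousTimeMarkovChain {Ω S : Type*} [MeasurableSpace Ω] [MeasurableSpace S]
    [DecidableEq S] (Q : S → S → ℝ) (Z : ℝ≥0 → Ω → S) (μ : Measure Ω) : Prop where
  measurable : ∀ t, Measurable (Z t)
  rightContinuous : ∀ (ω : Ω) (t : ℝ≥0), ∀ᶠ s in 𝓝[>] t, Z s ω = Z t ω
  nonExplosive : ∀ᵐ ω ∂μ, Tendsto (fun i => jumpTime (fun t => Z t ω) i) atTop (𝓝 ∞)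
  transition : ∀ (k : ℕ) (x : ℕ → S) (s : ℕ → ℝ≥0),
    μ.real {ω | (∀ i ≤ k + 1, embeddedChain (fun t => Z t ω) i = x i) ∧
        ∀ i < k + 1, (s i : ℝ≥0∞) <
          jumpTime (fun t => Z t ω) (i + 1) - jumpTime (fun t => Z t ω) i}
      = μ.real {ω | (∀ i ≤ k, embeddedChain (fun t => Z t ω) i = x i) ∧
          ∀ i < k, (s i : ℝ≥0∞) <
            jumpTime (fun t => Z t ω) (i + 1) - jumpTime (fun t => Z t ω) i}
        * (Real.exp (Q (x k) (x k) * s k) * jumpMatrix Q (x k) (x (k + 1)))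

/-- The rate matrix `Q_Z` on `ℤ`: from `a`, up with rate `q^{-a}`, down with rate `q^a`. -/
def birthDeathRate (q : ℝ) (a b : ℤ) : ℝ :=
  if b = a + 1 then q ^ (-a)
  else if b = a - 1 then q ^ a
  else if b = a then -q ^ a - q ^ (-a)
  else 0

/-- For even `n`, the rescaled, recentered process
`Y_t = X(2 ⌊q^{n/2} (q - 1) t⌋) - n / 2` of a sequence `x` in `{0, …, n}`. -/
def rescaled (q : ℝ) (n : ℕ) (x : ℕ → Fin (n + 1)) (t : ℝ≥0) : ℤ :=
  ((x (2 * ⌊q ^ ((n : ℝ) / 2) * (q - 1) * (t : ℝ)⌋₊) : ℕ) : ℤ) - (n : ℤ) / 2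

end RankCoupling

end

/-!
The two processes are compared through their *skeletons*. Write `δ` for the length of the time
interval in which `Y` makes one double step of `X`. A skeleton records, for each of the first `N`
jumps, its direction and the number of intervals of length `δ` that pass before it. For the birth
and death process `Z` this is a discretization of its holding times; for `Y` it is all there is to
know. Hence two paths with the same skeleton have the same embedded chain, and their `i`-th jump
times differ by at most `i * δ` (`jumpTime_rescaled_close`). This is far smaller than the error
allowed, so that it remains to couple the two skeletons such that they agree with high probability.

For this, a lower bound of the probability of each skeleton under `X` by its probability under `Z`
suffices. The law of `X` enters through the transition matrix, which is the law of the rank of a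
uniformly random matrix: from `n / 2 + b` the next state is `n / 2 - b`, except with a probability
close to `δ * q ^ (-b)`, when it is one less. Following only the most likely path of `X` with a given
skeleton, two steps at a time, each double step without a jump has probability at least
`1 - δ * (q ^ b + q ^ (-b))`, and a jump has probability at least `δ * q ^ (∓ b)` up to a factor close
to one (`two_step_stay_ge`, `two_step_up_ge`, `two_step_down_ge`). Comparing a geometric with a
discretized exponential variable gives `skeletonEvent_le_pathEvent`: for the skeletons that stay in
`[-L, L]` with `L = ⌊2 * α * n⌋` and have no holding time that exceeds its mean by a factor
`s = O(n)`, the probabilities are comparable up to a factor `(1 - η) ^ N` with `η` of order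
`s * q ^ (-(1 / 2 - 2 * α) * n)`. Since the events of different skeletons are disjoint, such a
domination yields a coupling (`exists_coupling`).

The process `Z` is built from independent innovations, an exponential variable and a uniform variable
per jump. A jump out of `[-L, L]` or a long holding time forces one of the first `N` innovations
into an exceptional set, so that a union bound applies (`measureReal_innovations_ge`). That the jump
times of `Z` grow linearly, which gives both non-explosion and the lower bound for the `N`-th jump
time, follows from the contraction of `exp (-T) * 1.1 ^ |Z|` along the jumps (`lintegral_lyapunov`).
With `y = q ^ (n / 50)` one has `N ≤ y ^ 8`, `η ≤ 36 * y ^ (-16)` and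
`q ^ (-2 * L) ≤ q ^ 2 * y ^ (-16)`, and all error probabilities are of order `y ^ (-8)`.
-/

namespace RankCoupling

/-! ### The transition matrix of the rank increments -/

lemma qPochhammer_succ (a q : ℝ) (r : ℕ) :
    qPochhammer a q (r + 1) = qPochhammer a q r * (1 - a * q ^ r) :=
  Finset.prod_range_succ _ _

lemma qPochhammer_zpow_succ {q : ℝ} (hq : q ≠ 0) (m : ℤ) (r : ℕ) :
    qPochhammer (q ^ (-(m + 1))) q (r + 1)
      = (1 - q ^ (-(m + 1))) * qPochhammer (q ^ (-m)) q r := by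
  unfold qPochhammer
  rw [Finset.prod_range_succ', mul_comm]
  congr 1
  · simp
  · refine Finset.prod_congr rfl fun i _ => ?_
    rw [← zpow_natCast, ← zpow_natCast, ← zpow_add₀ hq, ← zpow_add₀ hq]
    push_cast
    ring_nf

lemma qPochhammer_factor_pos {q : ℝ} (hq : 1 < q) {m : ℤ} {i : ℕ} (h : (i : ℤ) < m) :
    0 < 1 - q ^ (-m) * q ^ i := by
  rw [← zpow_natCast, ← zpow_add₀ (by positivity), sub_pos]
  exact zpow_lt_one_of_neg₀ hq (by lia)

lemma qPochhammer_pos {q : ℝ} (hq : 1 < q) {m : ℤ} {r : ℕ} (h : (r : ℤ) ≤ m) :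
    0 < qPochhammer (q ^ (-m)) q r :=
  Finset.prod_pos fun i hi => qPochhammer_factor_pos hq
    (lt_of_lt_of_le (by exact_mod_cast Finset.mem_range.1 hi) h)

lemma qPochhammer_le_one {q : ℝ} (hq : 1 < q) {m : ℤ} {r : ℕ} (h : (r : ℤ) ≤ m) :
    qPochhammer (q ^ (-m)) q r ≤ 1 := by
  refine Finset.prod_le_one (fun i hi => (qPochhammer_factor_pos hq
    (lt_of_lt_of_le (by exact_mod_cast Finset.mem_range.1 hi) h)).le) fun i hi => ?_
  have : 0 ≤ q ^ (-m) * q ^ i := by positivity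
  linarith

lemma qPochhammer_eq_zero {q : ℝ} (hq : q ≠ 0) {m r : ℕ} (h : m < r) :
    qPochhammer (q ^ (-(m : ℤ))) q r = 0 := by
  refine Finset.prod_eq_zero (Finset.mem_range.2 h) ?_
  rw [zpow_neg, zpow_natCast, inv_mul_cancel₀ (pow_ne_zero _ hq), sub_self]

/-- Bernoulli's inequality for the product `∏_{i < r} (1 - q ^ (i - m))`. -/
lemma one_sub_le_qPochhammer {q : ℝ} (hq : 1 < q) (m : ℤ) (r : ℕ) (h : (r : ℤ) ≤ m) :
    1 - q ^ ((r : ℤ) - m) / (q - 1) ≤ qPochhammer (q ^ (-m)) q r := by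
  have hq0 : q ≠ 0 := by positivity
  have hq1 : 0 < q - 1 := by linarith
  induction r with
  | zero =>
    simp only [qPochhammer, Finset.range_zero, Finset.prod_empty]
    have : 0 ≤ q ^ (((0 : ℕ) : ℤ) - m) / (q - 1) := by positivity
    linarith
  | succ r ih =>
    have hr : (r : ℤ) ≤ m := by push_cast at h; lia
    have h1 := ih hr
    have h2 := qPochhammer_le_one hq hr
    rw [qPochhammer_succ, ← zpow_natCast, ← zpow_add₀ hq0]
    have e1 : q ^ (((r + 1 : ℕ) : ℤ) - m) = q * q ^ ((r : ℤ) - m) := by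
      rw [← zpow_one_add₀ hq0]; push_cast; ring_nf
    have e2 : q ^ (-m + (r : ℤ)) = q ^ ((r : ℤ) - m) := by ring_nf
    rw [e1, e2]
    set z := q ^ ((r : ℤ) - m)
    have hz : 0 < z := by positivity
    have e3 : q * z / (q - 1) = z / (q - 1) + z := by field_simp; ring
    rw [e3]
    nlinarith

/-- The probability that a uniformly random `m × n` matrix over the field with `q` elements has
rank `r`. -/
noncomputable def rankLaw (q : ℝ) (n m r : ℕ) : ℝ :=
  q ^ (-(((m : ℤ) - r) * ((n : ℤ) - r)))
    * (qPochhammer (q ^ (-(m : ℤ))) q r * qPochhammer (q ^ (-(n : ℤ))) q r)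
    / qPochhammer (q ^ (-(r : ℤ))) q r

/-- Adding a row to a random matrix of rank `r` keeps the rank with probability `q ^ (r - n)`, and
increases it by one otherwise. -/
lemma rankLaw_succ_succ {q : ℝ} (hq : 1 < q) (n m r : ℕ) :
    rankLaw q n (m + 1) (r + 1)
      = rankLaw q n m (r + 1) * q ^ (((r + 1 : ℕ) : ℤ) - n)
        + rankLaw q n m r * (1 - q ^ ((r : ℤ) - n)) := by
  have hq0 : q ≠ 0 := by positivity
  have hr : qPochhammer (q ^ (-(r : ℤ))) q r ≠ 0 := (qPochhammer_pos hq le_rfl).ne'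
  have hr1 : 1 - q ^ (-((r : ℤ) + 1)) ≠ 0 := by
    have : q ^ (-((r : ℤ) + 1)) < 1 := zpow_lt_one_of_neg₀ hq (by lia)
    linarith
  unfold rankLaw
  push_cast
  rw [qPochhammer_zpow_succ hq0, qPochhammer_zpow_succ hq0, qPochhammer_succ (q ^ (-(m : ℤ))),
    qPochhammer_succ (q ^ (-(n : ℤ)))]
  simp only [← zpow_natCast (a := q), ← zpow_add₀ hq0]
  set A := qPochhammer (q ^ (-(m : ℤ))) q r
  set B := qPochhammer (q ^ (-(n : ℤ))) q r
  set D := qPochhammer (q ^ (-(r : ℤ))) q r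
  have e1 : q ^ (-(((m : ℤ) + 1 - (r + 1)) * (n - (r + 1))))
      = q ^ (-((m : ℤ) - (r + 1)) * (n - (r + 1))) * q ^ ((r : ℤ) + 1 - n) := by
    rw [← zpow_add₀ hq0]; ring_nf
  have e2 : q ^ (-(((m : ℤ) - r) * (n - r)))
      = q ^ (-((m : ℤ) - (r + 1)) * (n - (r + 1))) * q ^ ((r : ℤ) + 1 - n) * q ^ ((r : ℤ) - m) := by
    rw [← zpow_add₀ hq0, ← zpow_add₀ hq0]; ring_nf
  have e3 : q ^ (-((m : ℤ) + 1)) = q ^ ((r : ℤ) - m) * q ^ (-((r : ℤ) + 1)) := by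
    rw [← zpow_add₀ hq0]; ring_nf
  have e4 : q ^ (-(m : ℤ) + r) = q ^ ((r : ℤ) - m) := by ring_nf
  have e5 : q ^ (-(n : ℤ) + r) = q ^ ((r : ℤ) - n) := by ring_nf
  rw [e1, e2, e3, e4, e5, neg_mul]
  field_simp
  ring

lemma rankLaw_succ_zero {q : ℝ} (hq : 1 < q) (n m : ℕ) :
    rankLaw q n (m + 1) 0 = rankLaw q n m 0 * q ^ (((0 : ℕ) : ℤ) - n) := by
  have hq0 : q ≠ 0 := by positivity
  simp only [rankLaw, qPochhammer, Finset.range_zero, Finset.prod_empty, mul_one, div_one]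
  rw [← zpow_add₀ hq0]
  push_cast
  ring_nf

lemma rankLaw_eq_zero {q : ℝ} (hq : 1 < q) {n m r : ℕ} (h : m < r) : rankLaw q n m r = 0 := by
  rw [rankLaw, qPochhammer_eq_zero (by positivity) h]
  simp

lemma sum_rankLaw {q : ℝ} (hq : 1 < q) (n m : ℕ) :
    ∑ r ∈ Finset.range (m + 1), rankLaw q n m r = 1 := by
  induction m with
  | zero => simp [rankLaw, qPochhammer]
  | succ m ih =>
    rw [Finset.sum_range_succ']
    simp only [rankLaw_succ_succ hq, rankLaw_succ_zero hq]
    rw [Finset.sum_add_distrib, add_right_comm,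
      ← Finset.sum_range_succ' (fun r => rankLaw q n m r * q ^ ((r : ℤ) - n)),
      Finset.sum_range_succ, rankLaw_eq_zero hq (Nat.lt_succ_self m), zero_mul, add_zero,
      ← Finset.sum_add_distrib]
    exact (Finset.sum_congr rfl fun r _ => by ring).trans ih

lemma rankTransition_eq_rankLaw (q : ℝ) {n : ℕ} (d r : Fin (n + 1)) :
    rankTransition q n d r = if (d : ℕ) + r ≤ n then rankLaw q n (n - d) r else 0 := by
  have hd : (d : ℕ) ≤ n := Nat.lt_succ_iff.1 d.2
  unfold rankTransition rankLaw
  rw [Nat.cast_sub hd]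

lemma rankTransition_nonneg {q : ℝ} (hq : 1 < q) {n : ℕ} (d r : Fin (n + 1)) :
    0 ≤ rankTransition q n d r := by
  rw [rankTransition_eq_rankLaw]
  split_ifs with h
  · unfold rankLaw
    have h1 := qPochhammer_pos hq (m := ((n - d : ℕ) : ℤ)) (r := r) (by lia)
    have h2 := qPochhammer_pos hq (m := (n : ℤ)) (r := r) (by lia)
    have h3 := qPochhammer_pos hq (m := (r : ℤ)) (r := r) le_rfl
    positivity
  · exact le_rfl

lemma sum_rankTransition {q : ℝ} (hq : 1 < q) {n : ℕ} (d : Fin (n + 1)) :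
    ∑ r, rankTransition q n d r = 1 := by
  have hd : (d : ℕ) ≤ n := Nat.lt_succ_iff.1 d.2
  simp only [rankTransition_eq_rankLaw]
  rw [Fin.sum_univ_eq_sum_range (fun r => if (d : ℕ) + r ≤ n then rankLaw q n (n - d) r else 0),
    ← sum_rankLaw hq n (n - d), ← Finset.sum_filter]
  refine Finset.sum_congr ?_ fun _ _ => rfl
  ext r
  simp only [Finset.mem_filter, Finset.mem_range]
  lia

/-- A lower bound for the probability of a full rank increment. -/
lemma rankTransition_full_ge {q : ℝ} (hq : 1 < q) {n : ℕ} (d r : Fin (n + 1))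
    (h : (d : ℕ) + r = n) : 1 - q ^ (-(d : ℤ)) / (q - 1) ≤ rankTransition q n d r := by
  have hp : qPochhammer (q ^ (-((r : ℕ) : ℤ))) q r ≠ 0 := (qPochhammer_pos hq le_rfl).ne'
  have e : (n : ℤ) - d = ((r : ℕ) : ℤ) := by lia
  rw [rankTransition, if_pos h.le, e, sub_self, zero_mul, neg_zero, zpow_zero, one_mul,
    mul_div_assoc, mul_comm, div_mul_cancel₀ _ hp]
  convert one_sub_le_qPochhammer hq n r (by lia) using 4
  lia

/-- A lower bound for the probability of a rank increment of corank one. -/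
lemma rankTransition_corank_one_ge {q : ℝ} (hq : 2 ≤ q) {n : ℕ} (d r : Fin (n + 1))
    (h : (d : ℕ) + r + 1 = n) :
    q ^ (-(d : ℤ)) / (q - 1) * (1 - q ^ (-((n : ℤ) - d)) - q ^ (-(d : ℤ)))
      ≤ rankTransition q n d r := by
  have hq1 : 1 < q := by linarith
  have hq0 : q ≠ 0 := by positivity
  have hq2 : q - 1 ≠ 0 := by linarith
  have hp : 0 < qPochhammer (q ^ (-((r : ℕ) : ℤ))) q r := qPochhammer_pos hq1 le_rfl
  have e : (n : ℤ) - d = ((r : ℕ) : ℤ) + 1 := by lia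
  have e' : (n : ℤ) - r = (d : ℤ) + 1 := by lia
  have hs := qPochhammer_succ (q ^ (-(((r : ℕ) : ℤ) + 1))) q r
  rw [qPochhammer_zpow_succ hq0, ← zpow_natCast, ← zpow_add₀ hq0,
    show -(((r : ℕ) : ℤ) + 1) + ((r : ℕ) : ℤ) = -1 by ring, zpow_neg_one] at hs
  have hB := one_sub_le_qPochhammer hq1 n r (by lia)
  rw [rankTransition, if_pos (by lia), e, add_sub_cancel_left, one_mul, e',
    show q ^ (-((d : ℤ) + 1)) = q ^ (-(d : ℤ)) * q⁻¹ by
      rw [neg_add, zpow_add₀ hq0, zpow_neg_one]]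
  rw [show (r : ℤ) - n = -(d : ℤ) + -1 by lia, zpow_add₀ hq0, zpow_neg_one] at hB
  have hx1 : q ^ (-(((r : ℕ) : ℤ) + 1)) < 1 := zpow_lt_one_of_neg₀ hq1 (by lia)
  set A := qPochhammer (q ^ (-(((r : ℕ) : ℤ) + 1))) q r
  set B := qPochhammer (q ^ (-(n : ℤ))) q r
  set D := qPochhammer (q ^ (-((r : ℕ) : ℤ))) q r
  set x := q ^ (-(((r : ℕ) : ℤ) + 1))
  set z := q ^ (-(d : ℤ))
  have hz : 0 < z := by positivity
  have hx : 0 < x := by positivity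
  have hA : A = (1 - x) * D * q / (q - 1) := by
    have h1 : 1 - q⁻¹ ≠ 0 := by
      have : q⁻¹ < 1 := inv_lt_one_of_one_lt₀ hq1
      linarith
    rw [eq_div_iff hq2]
    field_simp at hs
    linarith
  have e1 : z * q⁻¹ * (A * B) / D = z / (q - 1) * ((1 - x) * B) := by
    rw [hA]; field_simp
  rw [e1]
  have h3 : z * q⁻¹ / (q - 1) ≤ z := by
    rw [div_le_iff₀ (by linarith)]
    have : q⁻¹ ≤ 1 := inv_le_one_of_one_le₀ hq1.le
    nlinarith
  have h4 : 0 ≤ z / (q - 1) := div_nonneg hz.le (by linarith)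
  refine mul_le_mul_of_nonneg_left ?_ h4
  nlinarith

/-! ### Coupling along two families of disjoint events -/

section Coupling

variable {Ω₁ Ω₂ : Type*} [MeasurableSpace Ω₁] [MeasurableSpace Ω₂]

/-- A partial coupling extends to a coupling: the missing mass of the two marginals is coupled
independently. -/
lemma exists_coupling_of_le {P : Measure Ω₁} {Q : Measure Ω₂} [IsProbabilityMeasure P]
    [IsProbabilityMeasure Q] {π : Measure (Ω₁ × Ω₂)} (h₁ : π.map Prod.fst ≤ P)
    (h₂ : π.map Prod.snd ≤ Q) :
    ∃ π' : Measure (Ω₁ × Ω₂), π ≤ π' ∧ π'.map Prod.fst = P ∧ π'.map Prod.snd = Q := by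
  have u₁ : π.map Prod.fst univ = π univ := by
    rw [Measure.map_apply measurable_fst .univ, preimage_univ]
  have u₂ : π.map Prod.snd univ = π univ := by
    rw [Measure.map_apply measurable_snd .univ, preimage_univ]
  have f₁ : IsFiniteMeasure (π.map Prod.fst) := isFiniteMeasure_of_le P h₁
  have f₂ : IsFiniteMeasure (π.map Prod.snd) := isFiniteMeasure_of_le Q h₂
  have m₁ : (P - π.map Prod.fst) univ = 1 - π univ := by
    rw [Measure.sub_apply .univ h₁, u₁, measure_univ]
  have m₂ : (Q - π.map Prod.snd) univ = 1 - π univ := by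
    rw [Measure.sub_apply .univ h₂, u₂, measure_univ]
  have s₁ := Measure.sub_add_cancel_of_le h₁
  have s₂ := Measure.sub_add_cancel_of_le h₂
  set P' := P - π.map Prod.fst
  set Q' := Q - π.map Prod.snd
  set r := 1 - π univ
  have hr : r ≠ ∞ := (tsub_le_self.trans_lt ENNReal.one_lt_top).ne
  have g₁ : IsFiniteMeasure P' := ⟨by rw [m₁]; exact hr.lt_top⟩
  have g₂ : IsFiniteMeasure Q' := ⟨by rw [m₂]; exact hr.lt_top⟩
  refine ⟨π + r⁻¹ • P'.prod Q', Measure.le_add_right le_rfl, ?_, ?_⟩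
  · rw [Measure.map_add _ _ measurable_fst, Measure.map_smul, Measure.map_fst_prod, m₂, smul_smul]
    rcases eq_or_ne r 0 with h0 | h0
    · rw [h0, Measure.measure_univ_eq_zero] at m₁
      rw [m₁, zero_add] at s₁
      rw [m₁, smul_zero, add_zero, s₁]
    · rw [ENNReal.inv_mul_cancel h0 hr, one_smul, add_comm, s₁]
  · rw [Measure.map_add _ _ measurable_snd, Measure.map_smul, Measure.map_snd_prod, m₁, smul_smul]
    rcases eq_or_ne r 0 with h0 | h0
    · rw [h0, Measure.measure_univ_eq_zero] at m₂
      rw [m₂, zero_add] at s₂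
      rw [m₂, smul_zero, add_zero, s₂]
    · rw [ENNReal.inv_mul_cancel h0 hr, one_smul, add_comm, s₂]

/-- If `P (A i)` dominates `c * Q (B i)` for two families of disjoint events, then `P` and `Q` can
be coupled such that, up to the factor `c`, the event `B i` is always accompanied by `A i`. -/
theorem exists_coupling {P : Measure Ω₁} {Q : Measure Ω₂} [IsProbabilityMeasure P]
    [IsProbabilityMeasure Q] {ι : Type*} [Countable ι] {A : ι → Set Ω₁} {B : ι → Set Ω₂}
    (hA : ∀ i, MeasurableSet (A i)) (hB : ∀ i, MeasurableSet (B i))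
    (dA : Pairwise (Function.onFun Disjoint A)) (dB : Pairwise (Function.onFun Disjoint B))
    {c : ℝ≥0∞} (hc : c ≤ 1) (h : ∀ i, c * Q (B i) ≤ P (A i)) :
    ∃ π : Measure (Ω₁ × Ω₂), π.map Prod.fst = P ∧ π.map Prod.snd = Q ∧
      c * Q (⋃ i, B i) ≤ π (⋃ i, A i ×ˢ B i) := by
  have hs : ∀ i, c * (P (A i))⁻¹ * P (A i) ≤ c := fun i => by
    rw [mul_assoc]
    exact (mul_le_mul_right (ENNReal.inv_mul_le_one _) c).trans_eq (mul_one c)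
  -- The part of the coupling on which the two families of events are matched.
  let π : Measure (Ω₁ × Ω₂) :=
    Measure.sum fun i => (c * (P (A i))⁻¹) • (P.restrict (A i)).prod (Q.restrict (B i))
  have h₁ : π.map Prod.fst ≤ P := by
    refine Measure.le_iff.2 fun s hs' => ?_
    rw [Measure.map_apply measurable_fst hs', Measure.sum_apply _ (measurable_fst hs')]
    calc _ ≤ ∑' i, P (A i ∩ s) := by
          refine ENNReal.tsum_le_tsum fun i => ?_
          rw [Measure.smul_apply, ← prod_univ, Measure.prod_prod, Measure.restrict_apply_univ,
            Measure.restrict_apply hs', inter_comm s, smul_eq_mul]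
          calc c * (P (A i))⁻¹ * (P (A i ∩ s) * Q (B i))
              = (c * Q (B i)) * (P (A i))⁻¹ * P (A i ∩ s) := by ring
            _ ≤ 1 * P (A i ∩ s) := by
                gcongr
                rw [← div_eq_mul_inv]
                exact ENNReal.div_le_of_le_mul (by simpa using h i)
            _ = _ := one_mul _
      _ = P (⋃ i, A i ∩ s) := (measure_iUnion
          (fun i j hij => (dA hij).mono inter_subset_left inter_subset_left)
          fun i => (hA i).inter hs').symm
      _ ≤ P s := measure_mono (iUnion_subset fun i => inter_subset_right)
  have h₂ : π.map Prod.snd ≤ Q := by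
    refine Measure.le_iff.2 fun s hs' => ?_
    rw [Measure.map_apply measurable_snd hs', Measure.sum_apply _ (measurable_snd hs')]
    calc _ ≤ ∑' i, Q (B i ∩ s) := by
          refine ENNReal.tsum_le_tsum fun i => ?_
          rw [Measure.smul_apply, ← univ_prod, Measure.prod_prod, Measure.restrict_apply_univ,
            Measure.restrict_apply hs', inter_comm s, smul_eq_mul, ← mul_assoc]
          exact (mul_le_mul_left ((hs i).trans hc) _).trans_eq (one_mul _)
      _ = Q (⋃ i, B i ∩ s) := (measure_iUnion
          (fun i j hij => (dB hij).mono inter_subset_left inter_subset_left)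
          fun i => (hB i).inter hs').symm
      _ ≤ Q s := measure_mono (iUnion_subset fun i => inter_subset_right)
  obtain ⟨π', hπ, e₁, e₂⟩ := exists_coupling_of_le h₁ h₂
  refine ⟨π', e₁, e₂, le_trans ?_ (hπ _)⟩
  have hU : MeasurableSet (⋃ i, A i ×ˢ B i) := MeasurableSet.iUnion fun i => (hA i).prod (hB i)
  rw [Measure.sum_apply _ hU, measure_iUnion dB hB, ← ENNReal.tsum_mul_left]
  refine ENNReal.tsum_le_tsum fun i => ?_
  rw [Measure.smul_apply, smul_eq_mul]
  refine le_trans ?_ (mul_le_mul_right (measure_mono (subset_iUnion _ i)) _)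
  rw [Measure.prod_prod, Measure.restrict_apply_self, Measure.restrict_apply_self, ← mul_assoc]
  -- If `P (A i) = 0`, its inverse is `∞`, but then `c * Q (B i) = 0` by `h`.
  rcases eq_or_ne (P (A i)) 0 with h0 | h0
  · have := h i
    rw [h0] at this ⊢
    simpa using this
  · rw [mul_assoc c, ENNReal.inv_mul_cancel h0 (measure_ne_top _ _), mul_one]

end Coupling

/-! ### Chains driven by independent innovations -/

/-- The chain started at `x₀` and driven by `φ`: from the state `x` it moves to `φ x (ω k)` in
step `k`. -/
def drivenChain {W S : Type*} (φ : S → W → S) (x₀ : S) (ω : ℕ → W) : ℕ → S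
  | 0 => x₀
  | k + 1 => φ (drivenChain φ x₀ ω k) (ω k)

lemma drivenChain_congr {W S : Type*} (φ : S → W → S) (x₀ : S) {ω ω' : ℕ → W} {k : ℕ}
    (h : ∀ i < k, ω i = ω' i) : drivenChain φ x₀ ω k = drivenChain φ x₀ ω' k := by
  induction k with
  | zero => rfl
  | succ k ih =>
    rw [drivenChain, drivenChain, ih fun i hi => h i (by lia), h k (by lia)]

section Innovations

variable {W : Type*} [MeasurableSpace W] (ν : Measure W) [IsProbabilityMeasure ν]

/-- The law of a sequence of independent innovations with common law `ν`. -/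
noncomputable abbrev iidLaw : Measure (ℕ → W) := Measure.infinitePi fun _ => ν

lemma indepFun_of_dependsOn {β : Type*} [MeasurableSpace β] {f : (ℕ → W) → β} {k : ℕ}
    (hf : Measurable f) (hd : DependsOn f (Iio k)) :
    ProbabilityTheory.IndepFun f (fun ω => ω k) (iidLaw ν) := by
  classical
  have hne : Nonempty W := nonempty_of_isProbabilityMeasure ν
  have hi : ProbabilityTheory.iIndepFun (fun (i : ℕ) (ω : ℕ → W) => ω i) (iidLaw ν) :=
    ProbabilityTheory.iIndepFun_infinitePi (X := fun _ => id) fun _ => measurable_id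
  have hj := hi.indepFun_finset (Finset.range k) {k} (by simp) fun i => measurable_pi_apply i
  let w₀ : W := hne.some
  let ext : (Finset.range k → W) → ℕ → W := fun v i =>
    if h : i ∈ Finset.range k then v ⟨i, h⟩ else w₀
  have hext : Measurable ext := by
    refine measurable_pi_iff.2 fun i => ?_
    by_cases h : i ∈ Finset.range k
    · simpa only [ext, h, dite_true] using measurable_pi_apply _
    · simpa only [ext, h, dite_false] using measurable_const
  have := hj.comp (φ := f ∘ ext)
    (ψ := fun v : ({k} : Finset ℕ) → W => v ⟨k, Finset.mem_singleton_self k⟩)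
    (hf.comp hext) (measurable_pi_apply (X := fun _ : ({k} : Finset ℕ) => W) _)
  have e : f = (f ∘ ext) ∘ fun ω (i : Finset.range k) => ω i := by
    funext ω
    refine hd fun i hi => ?_
    simp only [mem_Iio] at hi
    simp [ext, hi]
  rw [e]
  exact this

/-- The law of the innovation `ω k`, given a quantity that depends on the earlier ones only. -/
lemma lintegral_innovation {β : Type*} [MeasurableSpace β] {f : (ℕ → W) → β} {k : ℕ}
    (hf : Measurable f) (hd : DependsOn f (Iio k)) {G : β × W → ℝ≥0∞} (hG : Measurable G) :
    ∫⁻ ω, G (f ω, ω k) ∂iidLaw ν = ∫⁻ ω, ∫⁻ w, G (f ω, w) ∂ν ∂iidLaw ν := by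
  have h := (ProbabilityTheory.indepFun_iff_map_prod_eq_prod_map_map hf.aemeasurable
    (measurable_pi_apply k).aemeasurable).1 (indepFun_of_dependsOn ν hf hd)
  have hk : (iidLaw ν).map (fun ω => ω k) = ν := Measure.infinitePi_map_eval (fun _ => ν) k
  rw [hk] at h
  have h1 := lintegral_map (μ := iidLaw ν) hG (hf.prodMk (measurable_pi_apply k))
  rw [← h1, h, lintegral_prod _ hG.aemeasurable,
    lintegral_map hG.lintegral_prod_right' hf]

lemma iidLaw_real_inter {H : Set (ℕ → W)} {k : ℕ} (hH : MeasurableSet H)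
    (hd : DependsOn (fun ω => ω ∈ H) (Iio k)) {B : Set W} (hB : MeasurableSet B) :
    (iidLaw ν).real (H ∩ {ω | ω k ∈ B}) = (iidLaw ν).real H * ν.real B := by
  have h := (indepFun_of_dependsOn ν (f := fun ω => ω ∈ H) (measurable_mem.2 hH)
    hd).measure_inter_preimage_eq_mul {True} B (measurableSet_singleton _) hB
  have e : (fun ω => ω ∈ H) ⁻¹' {True} = H := by ext; simp
  have hk : (iidLaw ν) ((fun ω : ℕ → W => ω k) ⁻¹' B) = ν B := by
    rw [← Measure.map_apply (measurable_pi_apply k) hB]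
    congr 1
    exact Measure.infinitePi_map_eval (fun _ => ν) k
  rw [e, hk] at h
  rw [measureReal_def, measureReal_def, measureReal_def, ← ENNReal.toReal_mul, ← h]
  rfl

lemma iidLaw_innovation {B : Set W} (hB : MeasurableSet B) (k : ℕ) :
    (iidLaw ν) {ω | ω k ∈ B} = ν B := by
  change (iidLaw ν) ((fun ω : ℕ → W => ω k) ⁻¹' B) = ν B
  rw [← Measure.map_apply (measurable_pi_apply k) hB]
  congr 1
  exact Measure.infinitePi_map_eval (fun _ => ν) k

variable {S : Type*}

lemma measurable_drivenChain [MeasurableSpace S] [Countable S] [MeasurableSingletonClass S]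
    {φ : S → W → S} (hφ : ∀ x, Measurable (φ x)) (x₀ : S) (k : ℕ) :
    Measurable fun ω => drivenChain φ x₀ ω k := by
  induction k with
  | zero => exact measurable_const
  | succ k ih =>
    have : Measurable (fun p : S × W => φ p.1 p.2) := measurable_from_prod_countable_right hφ
    exact this.comp (ih.prodMk (measurable_pi_apply k))

/-- A chain driven by independent innovations is a Markov chain, whose transition probabilities are
those of a single innovation. -/
lemma isMarkovChain_drivenChain [MeasurableSpace S] [Countable S] [MeasurableSingletonClass S]
    {φ : S → W → S} (hφ : ∀ x, Measurable (φ x)) (x₀ : S) {P : S → S → ℝ}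
    (hP : ∀ x y, ν.real {w | φ x w = y} = P x y) :
    IsMarkovChain P (fun k ω => drivenChain φ x₀ ω k) (iidLaw ν) where
  measurable := measurable_drivenChain hφ x₀
  transition k x := by
    have hm := measurable_drivenChain hφ x₀
    have hH : MeasurableSet {ω | ∀ i ≤ k, drivenChain φ x₀ ω i = x i} := by
      simp only [ofPred_forall]
      exact .iInter fun i => .iInter fun _ => hm i (measurableSet_singleton _)
    have hd : DependsOn (fun ω => ω ∈ {ω | ∀ i ≤ k, drivenChain φ x₀ ω i = x i}) (Iio k) := by
      intro ω ω' h
      simp only [mem_ofPred_eq, eq_iff_iff]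
      refine forall₂_congr fun i hi => ?_
      rw [drivenChain_congr φ x₀ fun j hj => h j (lt_of_lt_of_le hj hi)]
    rw [← hP]
    refine Eq.trans ?_ (iidLaw_real_inter ν hH hd (hφ (x k) (measurableSet_singleton (x (k + 1)))))
    congr 1
    ext ω
    simp only [mem_inter_iff, mem_ofPred_eq]
    constructor
    · intro h
      refine ⟨fun i hi => h i (by lia), ?_⟩
      rw [← h k (by lia)]
      exact h (k + 1) le_rfl
    · rintro ⟨h1, h2⟩ i hi
      rcases Nat.le_succ_iff.1 hi with hi | rfl
      · exact h1 i hi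
      · rw [drivenChain, h1 k le_rfl]
        exact h2

end Innovations

/-- A Markov chain with a given stochastic matrix on a finite set, started at a given state. -/
theorem exists_isMarkovChain {S : Type} [Fintype S] [MeasurableSpace S]
    [MeasurableSingletonClass S] {P : S → S → ℝ} (h0 : ∀ x y, 0 ≤ P x y)
    (h1 : ∀ x, ∑ y, P x y = 1) (x₀ : S) :
    ∃ (Ω : Type) (_ : MeasurableSpace Ω) (μ : Measure Ω) (_ : IsProbabilityMeasure μ)
      (X : ℕ → Ω → S), IsMarkovChain P X μ ∧ ∀ ω, X 0 ω = x₀ := by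
  let row : S → PMF S := fun x => PMF.ofFintype (fun y => ENNReal.ofReal (P x y)) (by
    rw [← ENNReal.ofReal_sum_of_nonneg fun y _ => h0 x y, h1, ENNReal.ofReal_one])
  let ν : Measure (S → S) := Measure.pi fun x => (row x).toMeasure
  refine ⟨ℕ → S → S, inferInstance, iidLaw ν, inferInstance,
    fun k ω => drivenChain (fun x w => w x) x₀ ω k,
    isMarkovChain_drivenChain ν (fun x => measurable_pi_apply x) x₀ fun x y => ?_, fun _ => rfl⟩
  have hm := (measurePreserving_eval (fun x => (row x).toMeasure) x).measure_preimage
    (measurableSet_singleton y).nullMeasurableSet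
  rw [PMF.toMeasure_apply_singleton _ _ (measurableSet_singleton y), PMF.ofFintype_apply] at hm
  rw [measureReal_def]
  change (ν (Function.eval x ⁻¹' {y})).toReal = _
  rw [hm, ENNReal.toReal_ofReal (h0 x y)]

lemma IsMarkovChain.comp_measurePreserving {Ω Ω' S : Type*} [MeasurableSpace Ω]
    [MeasurableSpace Ω'] [MeasurableSpace S] [MeasurableSingletonClass S] {P : S → S → ℝ}
    {X : ℕ → Ω → S} {μ : Measure Ω} (h : IsMarkovChain P X μ) {μ' : Measure Ω'} {f : Ω' → Ω}
    (hf : MeasurePreserving f μ' μ) : IsMarkovChain P (fun k ω => X k (f ω)) μ' where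
  measurable k := (h.measurable k).comp hf.measurable
  transition k x := by
    have hm : ∀ k, MeasurableSet {ω | ∀ i ≤ k, X i ω = x i} := fun k => by
      simp only [ofPred_forall]
      exact .iInter fun i => .iInter fun _ => h.measurable i (measurableSet_singleton _)
    have := h.transition k x
    rw [← hf.measureReal_preimage (hm _).nullMeasurableSet,
      ← hf.measureReal_preimage (hm _).nullMeasurableSet] at this
    exact this

/-! ### Path events of Markov chains -/

section PathEvent

variable {Ω S : Type*}

/-- The event that `X` follows the path `l` from time `0` on; the last state of the path is the head
of the list. -/
def pathEvent (X : ℕ → Ω → S) : List S → Set Ω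
  | [] => univ
  | s :: l => pathEvent X l ∩ {ω | X l.length ω = s}

lemma measurableSet_pathEvent [MeasurableSpace Ω] [MeasurableSpace S] [MeasurableSingletonClass S]
    {X : ℕ → Ω → S} (hX : ∀ i, Measurable (X i)) (l : List S) : MeasurableSet (pathEvent X l) := by
  induction l with
  | nil => exact .univ
  | cons s l ih => exact ih.inter (hX _ (measurableSet_singleton s))

lemma exists_pathEvent_eq (X : ℕ → Ω → S) (s : S) (l : List S) :
    ∃ x : ℕ → S, x l.length = s ∧ pathEvent X (s :: l) = {ω | ∀ i ≤ l.length, X i ω = x i} := by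
  induction l generalizing s with
  | nil => exact ⟨fun _ => s, rfl, by ext; simp [pathEvent]⟩
  | cons t l ih =>
    obtain ⟨x, hx, h⟩ := ih t
    refine ⟨Function.update x (l.length + 1) s, by simp, ?_⟩
    rw [pathEvent, h]
    ext ω
    simp only [mem_inter_iff, mem_ofPred_eq, List.length_cons]
    constructor
    · rintro ⟨h1, h2⟩ i hi
      rcases Nat.le_succ_iff.1 hi with hi | rfl
      · rw [Function.update_of_ne (by lia), h1 i hi]
      · rw [h2, Function.update_self]
    · intro h
      refine ⟨fun i hi => ?_, ?_⟩
      · rw [h i (by lia), Function.update_of_ne (by lia)]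
      · rw [h _ le_rfl, Function.update_self]

lemma IsMarkovChain.pathEvent_cons_cons [MeasurableSpace Ω] [MeasurableSpace S] {P : S → S → ℝ}
    {X : ℕ → Ω → S} {μ : Measure Ω} (h : IsMarkovChain P X μ) (r s : S) (l : List S) :
    μ.real (pathEvent X (r :: s :: l)) = μ.real (pathEvent X (s :: l)) * P s r := by
  obtain ⟨x, hx, e⟩ := exists_pathEvent_eq X s l
  have := h.transition l.length (Function.update x (l.length + 1) r)
  rw [Function.update_self, Function.update_of_ne (by lia), hx] at this
  have e1 : {ω | ∀ i ≤ l.length, X i ω = Function.update x (l.length + 1) r i}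
      = pathEvent X (s :: l) := by
    rw [e]
    ext ω
    refine forall₂_congr fun i hi => ?_
    rw [Function.update_of_ne (by lia)]
  rw [e1] at this
  rw [← this, pathEvent, ← e1]
  congr 1
  ext ω
  simp only [mem_inter_iff, mem_ofPred_eq, List.length_cons]
  constructor
  · rintro ⟨h1, h2⟩ i hi
    rcases Nat.le_succ_iff.1 hi with hi | rfl
    · exact h1 i hi
    · rw [h2, Function.update_self]
  · intro h
    exact ⟨fun i hi => h i (by lia), by rw [h _ le_rfl, Function.update_self]⟩

end PathEvent

/-! ### Jump times of step paths -/

section StepPath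

variable {S : Type*}

/-- The jump times and the embedded chain of a path that is known, up to its `N`-th jump, to be
a step path. -/
lemma jumpTime_eq_and_embeddedChain_eq {z : ℝ≥0 → S} {T : ℕ → ℝ≥0} {x : ℕ → S} {N : ℕ}
    (h0 : T 0 = 0) (hT : ∀ i < N, T i < T (i + 1))
    (hz : ∀ i < N, ∀ u, T i ≤ u → u < T (i + 1) → z u = x i) (hN : z (T N) = x N)
    (hx : ∀ i < N, x (i + 1) ≠ x i) :
    ∀ i ≤ N, jumpTime z i = T i ∧ embeddedChain z i = x i := by
  have hzT : ∀ i ≤ N, z (T i) = x i := fun i hi => by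
    rcases hi.lt_or_eq with h | rfl
    · exact hz i h _ le_rfl (hT i h)
    · exact hN
  suffices h : ∀ i ≤ N, jumpTime z i = T i from fun i hi => ⟨h i hi, by
    rw [embeddedChain, h i hi, ENNReal.toNNReal_coe, hzT i hi]⟩
  intro i
  induction i with
  | zero => intro _; rw [jumpTime, h0, ENNReal.coe_zero]
  | succ i ih =>
    intro hi
    rw [jumpTime, ih (by lia), ENNReal.toNNReal_coe, hzT i (by lia)]
    apply le_antisymm
    · have h : z (T (i + 1)) ≠ x i := by
        rw [hzT _ hi]
        exact hx i hi
      exact iInf₂_le (T (i + 1)) ⟨ENNReal.coe_lt_coe.2 (hT i hi), h⟩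
    · refine le_iInf₂ fun u hu => ENNReal.coe_le_coe.2 ?_
      by_contra! hlt
      exact hu.2 (hz i hi u (ENNReal.coe_lt_coe.1 hu.1).le hlt)

/-- The path that visits `x 0, x 1, …` and leaves `x i` at time `T (i + 1)`. -/
noncomputable def stepPath (T : ℕ → ℝ≥0) (x : ℕ → S) (t : ℝ≥0) : S :=
  x (sInf {i | t < T (i + 1)})

lemma stepPath_eq {T : ℕ → ℝ≥0} (hT : Monotone T) (x : ℕ → S) {i : ℕ} {t : ℝ≥0} (h : T i ≤ t)
    (h' : t < T (i + 1)) : stepPath T x t = x i := by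
  have hne : {i | t < T (i + 1)}.Nonempty := ⟨i, h'⟩
  have h1 : sInf {i | t < T (i + 1)} ≤ i := Nat.sInf_le h'
  have h2 : t < T (sInf {i | t < T (i + 1)} + 1) := Nat.sInf_mem hne
  rw [stepPath, h1.antisymm]
  by_contra! hlt
  exact absurd (h.trans_lt h2) (not_lt.2 (hT hlt))

lemma exists_mem_step {T : ℕ → ℝ≥0} (h0 : T 0 = 0) {t : ℝ≥0} (ht : ∃ k, t < T k) :
    ∃ i, T i ≤ t ∧ t < T (i + 1) := by
  classical
  have h1 := Nat.find_spec ht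
  obtain ⟨i, hi⟩ : ∃ i, Nat.find ht = i + 1 :=
    Nat.exists_eq_succ_of_ne_zero fun h => by rw [h, h0] at h1; exact not_lt_bot h1
  rw [hi] at h1
  exact ⟨i, not_lt.1 (Nat.find_min ht (by lia)), h1⟩

end StepPath

/-! ### The birth and death process -/

/-- The total jump rate of the birth and death process in the state `b`. -/
noncomputable def totalRate (q : ℝ) (b : ℤ) : ℝ := q ^ b + q ^ (-b)

/-- The probability that the birth and death process leaves the state `b` upwards. -/
noncomputable def upProb (q : ℝ) (b : ℤ) : ℝ := q ^ (-b) / totalRate q b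

section Rates

variable {q : ℝ} (hq : 2 ≤ q)
include hq

lemma totalRate_pos (b : ℤ) : 0 < totalRate q b := by
  have : 0 < q := by linarith
  unfold totalRate; positivity

lemma upProb_nonneg (b : ℤ) : 0 ≤ upProb q b :=
  div_nonneg (zpow_nonneg (by linarith) _) (totalRate_pos hq b).le

lemma one_sub_upProb (b : ℤ) : 1 - upProb q b = q ^ b / totalRate q b := by
  have h := (totalRate_pos hq b).ne'
  rw [upProb, eq_div_iff h, sub_mul, div_mul_cancel₀ _ h, totalRate]
  ring

lemma one_sub_upProb_eq (b : ℤ) : 1 - upProb q b = upProb q (-b) := by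
  rw [one_sub_upProb hq, upProb, totalRate, totalRate, neg_neg, add_comm]

lemma upProb_le_one (b : ℤ) : upProb q b ≤ 1 := by
  have := upProb_nonneg hq (-b)
  rw [← one_sub_upProb_eq hq] at this
  linarith

lemma upProb_le (b : ℤ) : upProb q b ≤ q ^ (-2 * b) := by
  have hq0 : 0 < q := by linarith
  rw [upProb, div_le_iff₀ (totalRate_pos hq b), totalRate, mul_add, ← zpow_add₀ hq0.ne',
    show -2 * b + b = -b by ring]
  have : 0 ≤ q ^ (-2 * b) * q ^ (-b) := by positivity
  linarith

lemma upProb_le_fifth {b : ℤ} (hb : 0 < b) : upProb q b ≤ 1 / 5 := by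
  have hq0 : 0 < q := by linarith
  have h1 : q ^ (1 : ℤ) ≤ q ^ b := zpow_le_zpow_right₀ (by linarith) (by lia)
  rw [zpow_one] at h1
  rw [upProb, div_le_iff₀ (totalRate_pos hq b), totalRate, zpow_neg]
  have h2 : (q ^ b)⁻¹ ≤ 1 / 2 := by
    rw [inv_eq_one_div]
    exact one_div_le_one_div_of_le two_pos (by linarith)
  linarith

end Rates

/-- The law of an innovation of the birth and death process: a standard exponential variable, which
gives the holding time, and an independent uniform variable, which gives the direction. -/
noncomputable def innovationLaw : Measure (ℝ × ℝ) :=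
  (ProbabilityTheory.expMeasure 1).prod (volume.restrict (Icc 0 1))

instance : IsProbabilityMeasure (ProbabilityTheory.expMeasure 1) :=
  ProbabilityTheory.isProbabilityMeasure_expMeasure one_pos

instance : IsProbabilityMeasure ((volume : Measure ℝ).restrict (Icc 0 1)) :=
  ⟨by simp⟩

instance : IsProbabilityMeasure innovationLaw := by
  unfold innovationLaw; infer_instance

lemma expMeasure_real_Ioi {s : ℝ} (hs : 0 ≤ s) :
    (ProbabilityTheory.expMeasure 1).real (Ioi s) = Real.exp (-s) := by
  have h := ProbabilityTheory.cdf_expMeasure_eq one_pos s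
  rw [ProbabilityTheory.cdf_eq_real, if_pos hs, one_mul] at h
  rw [← compl_Iic, probReal_compl_eq_one_sub measurableSet_Iic, h]
  ring

lemma uniform_real_Iio {p : ℝ} (h0 : 0 ≤ p) (h1 : p ≤ 1) :
    ((volume : Measure ℝ).restrict (Icc 0 1)).real (Iio p) = p := by
  rw [measureReal_restrict_apply measurableSet_Iio]
  have : Iio p ∩ Icc 0 1 = Ico 0 p := by
    ext u
    simp only [mem_inter_iff, mem_Iio, mem_Icc, mem_Ico]
    constructor
    · rintro ⟨a, b, c⟩; exact ⟨b, a⟩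
    · rintro ⟨a, b⟩; exact ⟨b, a, by linarith⟩
  rw [this, Real.volume_real_Ico_of_le h0, sub_zero]

lemma uniform_real_Ici {p : ℝ} (h0 : 0 ≤ p) (h1 : p ≤ 1) :
    ((volume : Measure ℝ).restrict (Icc 0 1)).real (Ici p) = 1 - p := by
  rw [← compl_Iio, probReal_compl_eq_one_sub measurableSet_Iio, uniform_real_Iio h0 h1]

lemma innovationLaw_real_prod (A B : Set ℝ) :
    innovationLaw.real (A ×ˢ B) = (ProbabilityTheory.expMeasure 1).real A
      * ((volume : Measure ℝ).restrict (Icc 0 1)).real B :=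
  measureReal_prod_prod _ _

lemma innovationLaw_real_fst {s : ℝ} (hs : 0 ≤ s) :
    innovationLaw.real {w | s < w.1} = Real.exp (-s) := by
  have : {w : ℝ × ℝ | s < w.1} = Ioi s ×ˢ univ := by ext; simp
  rw [this, innovationLaw_real_prod, probReal_univ, mul_one, expMeasure_real_Ioi hs]

lemma innovationLaw_real_fst_le {s : ℝ} (hs : 0 ≤ s) :
    innovationLaw.real {w | w.1 ≤ s} = 1 - Real.exp (-s) := by
  rw [← innovationLaw_real_fst hs, ← probReal_compl_eq_one_sub
    (measurableSet_lt measurable_const measurable_fst)]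
  congr 1
  ext w
  simp

lemma innovationLaw_real_snd_lt {p : ℝ} (h0 : 0 ≤ p) (h1 : p ≤ 1) :
    innovationLaw.real {w | w.2 < p} = p := by
  have : {w : ℝ × ℝ | w.2 < p} = univ ×ˢ Iio p := by ext; simp
  rw [this, innovationLaw_real_prod, probReal_univ, one_mul, uniform_real_Iio h0 h1]

lemma innovationLaw_real_snd_ge {p : ℝ} (h0 : 0 ≤ p) (h1 : p ≤ 1) :
    innovationLaw.real {w | p ≤ w.2} = 1 - p := by
  have : {w : ℝ × ℝ | p ≤ w.2} = univ ×ˢ Ici p := by ext; simp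
  rw [this, innovationLaw_real_prod, probReal_univ, one_mul, uniform_real_Ici h0 h1]

/-- The state to which the birth and death process moves from `b`. -/
noncomputable def zStep (q : ℝ) (b : ℤ) (w : ℝ × ℝ) : ℤ :=
  if w.2 < upProb q b then b + 1 else b - 1

/-- The holding time of the birth and death process in the state `b`. -/
noncomputable def holdingTime (q : ℝ) (b : ℤ) (w : ℝ × ℝ) : ℝ≥0 :=
  (w.1 / totalRate q b).toNNReal

/-- The embedded chain of the birth and death process. -/
noncomputable def zState (q : ℝ) (a : ℤ) (ω : ℕ → ℝ × ℝ) (k : ℕ) : ℤ :=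
  drivenChain (zStep q) a ω k

/-- The jump times of the birth and death process. -/
noncomputable def zTime (q : ℝ) (a : ℤ) (ω : ℕ → ℝ × ℝ) (k : ℕ) : ℝ≥0 :=
  ∑ i ∈ Finset.range k, holdingTime q (zState q a ω i) (ω i)

/-- The event that all holding times are positive and the jump times are unbounded. -/
def regularEvent (q : ℝ) (a : ℤ) : Set (ℕ → ℝ × ℝ) :=
  {ω | (∀ i, 0 < (ω i).1) ∧ ∀ m : ℕ, ∃ k, (m : ℝ≥0) < zTime q a ω k}

open Classical in
/-- The birth and death process started at `a`. Off the regular event, which has probability one,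
it is constant, so that all its paths are right continuous. -/
noncomputable def zPath (q : ℝ) (a : ℤ) (t : ℝ≥0) (ω : ℕ → ℝ × ℝ) : ℤ :=
  if ω ∈ regularEvent q a then stepPath (zTime q a ω) (zState q a ω) t else a

section Paths

variable (q : ℝ) (a : ℤ)

lemma zState_succ (ω : ℕ → ℝ × ℝ) (k : ℕ) :
    zState q a ω (k + 1) = zStep q (zState q a ω k) (ω k) := rfl

lemma zTime_succ (ω : ℕ → ℝ × ℝ) (k : ℕ) :
    zTime q a ω (k + 1) = zTime q a ω k + holdingTime q (zState q a ω k) (ω k) :=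
  Finset.sum_range_succ _ _

lemma zStep_ne (b : ℤ) (w : ℝ × ℝ) : zStep q b w ≠ b := by
  unfold zStep; split_ifs <;> lia

lemma zTime_monotone (ω : ℕ → ℝ × ℝ) : Monotone (zTime q a ω) :=
  monotone_nat_of_le_succ fun k => by rw [zTime_succ]; exact le_self_add

lemma zState_congr {ω ω' : ℕ → ℝ × ℝ} {k : ℕ} (h : ∀ i < k, ω i = ω' i) :
    zState q a ω k = zState q a ω' k := drivenChain_congr _ _ h

lemma zTime_congr {ω ω' : ℕ → ℝ × ℝ} {k : ℕ} (h : ∀ i < k, ω i = ω' i) :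
    zTime q a ω k = zTime q a ω' k := by
  refine Finset.sum_congr rfl fun i hi => ?_
  have hi := Finset.mem_range.1 hi
  rw [h i hi, zState_congr q a fun j hj => h j (hj.trans hi)]

lemma measurable_zStep (b : ℤ) : Measurable (zStep q b) :=
  Measurable.ite (measurableSet_lt measurable_snd measurable_const) measurable_const
    measurable_const

lemma measurable_holdingTime (b : ℤ) : Measurable (holdingTime q b) :=
  (measurable_fst.div_const _).real_toNNReal

lemma measurable_zState (k : ℕ) : Measurable fun ω => zState q a ω k :=
  measurable_drivenChain (measurable_zStep q) a k

lemma measurable_zTime (k : ℕ) : Measurable fun ω => zTime q a ω k := by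
  have : Measurable (fun p : ℤ × (ℝ × ℝ) => holdingTime q p.1 p.2) :=
    measurable_from_prod_countable_right (measurable_holdingTime q)
  exact Finset.measurable_sum _ fun i _ =>
    this.comp ((measurable_zState q a i).prodMk (measurable_pi_apply i))

lemma measurableSet_regularEvent : MeasurableSet (regularEvent q a) := by
  have e : regularEvent q a = (⋂ i, {ω | 0 < (ω i).1})
      ∩ ⋂ m : ℕ, ⋃ k, {ω | (m : ℝ≥0) < zTime q a ω k} := by
    ext ω
    simp [regularEvent]
  rw [e]
  refine .inter (.iInter fun i => ?_) (.iInter fun m => .iUnion fun k => ?_)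
  · exact measurableSet_lt measurable_const (measurable_fst.comp (measurable_pi_apply i))
  · exact measurableSet_lt measurable_const (measurable_zTime q a k)

lemma exists_lt_zTime {ω : ℕ → ℝ × ℝ} (h : ω ∈ regularEvent q a) (t : ℝ≥0) :
    ∃ k, t < zTime q a ω k := by
  obtain ⟨k, hk⟩ := h.2 ⌈t⌉₊
  exact ⟨k, (Nat.le_ceil t).trans_lt hk⟩

lemma zPath_eq {ω : ℕ → ℝ × ℝ} (h : ω ∈ regularEvent q a) {i : ℕ} {t : ℝ≥0}
    (h1 : zTime q a ω i ≤ t) (h2 : t < zTime q a ω (i + 1)) : zPath q a t ω = zState q a ω i := by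
  rw [zPath, if_pos h, stepPath_eq (zTime_monotone q a ω) _ h1 h2]

lemma measurable_zPath (t : ℝ≥0) : Measurable (zPath q a t) := by
  refine measurable_to_countable' fun b => ?_
  have e : zPath q a t ⁻¹' {b} = (⋃ i, regularEvent q a ∩ ({ω | zTime q a ω i ≤ t}
      ∩ ({ω | t < zTime q a ω (i + 1)} ∩ {ω | zState q a ω i = b})))
      ∪ ((regularEvent q a)ᶜ ∩ {_ω | a = b}) := by
    ext ω
    simp only [mem_preimage, mem_singleton_iff, mem_union, mem_iUnion, mem_inter_iff,
      mem_ofPred_eq, mem_compl_iff]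
    by_cases h : ω ∈ regularEvent q a
    · simp only [h, true_and, not_true, false_and, or_false]
      constructor
      · intro hb
        obtain ⟨i, h1, h2⟩ := exists_mem_step (Finset.sum_range_zero _) (exists_lt_zTime q a h t)
        exact ⟨i, h1, h2, by rw [← hb, zPath_eq q a h h1 h2]⟩
      · rintro ⟨i, h1, h2, rfl⟩
        exact zPath_eq q a h h1 h2
    · simp [h, zPath]
  rw [e]
  refine .union (.iUnion fun i => (measurableSet_regularEvent q a).inter ?_)
    ((measurableSet_regularEvent q a).compl.inter (.const _))
  exact (measurableSet_le (measurable_zTime q a i) measurable_const).inter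
    ((measurableSet_lt measurable_const (measurable_zTime q a _)).inter
      (measurable_zState q a i (measurableSet_singleton b)))

lemma zPath_rightContinuous (ω : ℕ → ℝ × ℝ) (t : ℝ≥0) :
    ∀ᶠ s in 𝓝[>] t, zPath q a s ω = zPath q a t ω := by
  by_cases h : ω ∈ regularEvent q a
  · obtain ⟨i, h1, h2⟩ := exists_mem_step (Finset.sum_range_zero _) (exists_lt_zTime q a h t)
    filter_upwards [Ioo_mem_nhdsGT h2] with s hs
    rw [zPath_eq q a h h1 h2, zPath_eq q a h (h1.trans hs.1.le) hs.2]
  · simp [zPath, h]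

variable {q}
variable (hq : 2 ≤ q)
include hq

lemma holdingTime_pos {b : ℤ} {w : ℝ × ℝ} (hw : 0 < w.1) : 0 < holdingTime q b w :=
  Real.toNNReal_pos.2 (div_pos hw (totalRate_pos hq b))

lemma coe_holdingTime {b : ℤ} {w : ℝ × ℝ} (hw : 0 ≤ w.1) :
    (holdingTime q b w : ℝ) = w.1 / totalRate q b :=
  Real.coe_toNNReal _ (div_nonneg hw (totalRate_pos hq b).le)

lemma jumpTime_zPath {ω : ℕ → ℝ × ℝ} (h : ω ∈ regularEvent q a) (i : ℕ) :
    jumpTime (fun t => zPath q a t ω) i = zTime q a ω i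
      ∧ embeddedChain (fun t => zPath q a t ω) i = zState q a ω i := by
  have hlt : ∀ i, zTime q a ω i < zTime q a ω (i + 1) := fun i => by
    rw [zTime_succ]
    exact lt_add_of_pos_right _ (holdingTime_pos hq (h.1 i))
  refine jumpTime_eq_and_embeddedChain_eq (N := i) (Finset.sum_range_zero _) (fun i _ => hlt i)
    (fun i _ u h1 h2 => zPath_eq q a h h1 h2) (zPath_eq q a h le_rfl (hlt i))
    (fun i _ => zStep_ne q _ _) i le_rfl

lemma zPath_zero (ω : ℕ → ℝ × ℝ) : zPath q a 0 ω = a := by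
  by_cases h : ω ∈ regularEvent q a
  · refine zPath_eq q a h (i := 0) (by simp [zTime]) ?_
    rw [zTime_succ]
    exact lt_of_lt_of_le (holdingTime_pos hq (h.1 0)) le_add_self
  · simp [zPath, h]

end Paths

/-! ### An exponential Lyapunov function for the birth and death process -/

section Lyapunov

variable {q : ℝ}

lemma lintegral_innovationLaw_le {f : ℝ × ℝ → ℝ} {S : Set (ℝ × ℝ)} (hS : MeasurableSet S)
    {A B p : ℝ} (hA : 0 ≤ A) (hB : 0 ≤ B) (hf : ∀ w, f w ≤ A + S.indicator (fun _ => B) w)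
    (hp : innovationLaw.real S ≤ p) :
    ∫⁻ w, ENNReal.ofReal (f w) ∂innovationLaw ≤ ENNReal.ofReal (A + B * p) := by
  have hp0 : 0 ≤ p := measureReal_nonneg.trans hp
  calc ∫⁻ w, ENNReal.ofReal (f w) ∂innovationLaw
      ≤ ∫⁻ w, (ENNReal.ofReal A + S.indicator (fun _ => ENNReal.ofReal B) w) ∂innovationLaw := by
        refine lintegral_mono fun w => ?_
        refine (ENNReal.ofReal_le_ofReal (hf w)).trans ?_
        by_cases hw : w ∈ S
        · simp only [indicator_of_mem hw]
          exact ENNReal.ofReal_add_le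
        · simp [indicator_of_notMem hw]
    _ = ENNReal.ofReal A + ENNReal.ofReal B * innovationLaw S := by
        rw [lintegral_add_left measurable_const, lintegral_const, measure_univ, mul_one,
          lintegral_indicator_const hS]
    _ ≤ ENNReal.ofReal A + ENNReal.ofReal B * ENNReal.ofReal p := by
        gcongr
        rw [← ofReal_measureReal]
        exact ENNReal.ofReal_le_ofReal hp
    _ = ENNReal.ofReal (A + B * p) := by
        rw [← ENNReal.ofReal_mul hB, ENNReal.ofReal_add hA (by positivity)]

variable (hq : 2 ≤ q)
include hq

/-- Away from `0` the drift towards `0` makes the Lyapunov function `1.1 ^ |b|` decrease on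
average; at `0` the discount of the holding time does. -/
lemma lintegral_lyapunov_step (b : ℤ) :
    ∫⁻ w, ENNReal.ofReal (Real.exp (-holdingTime q b w)
        * (11 / 10 : ℝ) ^ (zStep q b w).natAbs) ∂innovationLaw
      ≤ ENNReal.ofReal (97 / 100 * (11 / 10 : ℝ) ^ b.natAbs) := by
  have hu0 := upProb_nonneg hq b
  have hu1 := upProb_le_one hq b
  have hexp : ∀ w, Real.exp (-(holdingTime q b w : ℝ)) ≤ 1 := fun w =>
    Real.exp_le_one_iff.2 (neg_nonpos.2 (NNReal.coe_nonneg _))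
  -- The bound away from `0`, where `O` is the event of a step away from `0`.
  have key : ∀ O : Set (ℝ × ℝ), MeasurableSet O → innovationLaw.real O ≤ 1 / 5 →
      (∀ w ∈ O, (zStep q b w).natAbs = b.natAbs + 1) →
      (∀ w ∉ O, (zStep q b w).natAbs + 1 = b.natAbs) →
      ∫⁻ w, ENNReal.ofReal (Real.exp (-holdingTime q b w)
        * (11 / 10 : ℝ) ^ (zStep q b w).natAbs) ∂innovationLaw
      ≤ ENNReal.ofReal (97 / 100 * (11 / 10 : ℝ) ^ b.natAbs) := by
    intro O hO hp h1 h2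
    have hc : 0 < (11 / 10 : ℝ) ^ b.natAbs := by positivity
    refine (lintegral_innovationLaw_le hO (A := (11 / 10 : ℝ) ^ b.natAbs * (10 / 11))
      (B := (11 / 10 : ℝ) ^ b.natAbs * (21 / 110)) (by positivity) (by positivity)
      (fun w => ?_) hp).trans (ENNReal.ofReal_le_ofReal (by nlinarith))
    refine (mul_le_of_le_one_left (by positivity) (hexp w)).trans ?_
    by_cases hw : w ∈ O
    · rw [indicator_of_mem hw, h1 w hw, pow_succ]
      nlinarith
    · rw [indicator_of_notMem hw, ← h2 w hw, pow_succ]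
      exact le_of_eq (by ring)
  rcases lt_trichotomy b 0 with hb | rfl | hb
  · refine key {w | upProb q b ≤ w.2} (measurableSet_le measurable_const measurable_snd) ?_ ?_ ?_
    · rw [innovationLaw_real_snd_ge hu0 hu1, one_sub_upProb_eq hq]
      exact upProb_le_fifth hq (by lia)
    · intro w hw
      rw [zStep, if_neg (not_lt.2 hw)]
      lia
    · intro w hw
      rw [zStep, if_pos (not_le.1 hw)]
      lia
  · have hl : 0 ≤ 2 * Real.log 2 := by positivity
    have he : Real.exp (-(2 * Real.log 2)) = 1 / 4 := by
      rw [Real.exp_neg, two_mul, Real.exp_add, Real.exp_log two_pos]; norm_num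
    refine (lintegral_innovationLaw_le (S := {w | w.1 ≤ 2 * Real.log 2})
      (measurableSet_le measurable_fst measurable_const) (A := 11 / 20) (B := 11 / 20)
      (p := 3 / 4) (by norm_num) (by norm_num) (fun w => ?_) ?_).trans
      (ENNReal.ofReal_le_ofReal (by norm_num))
    · have h1 : (zStep q 0 w).natAbs = 1 := by
        unfold zStep; split_ifs <;> rfl
      rw [h1]
      by_cases hw : w ∈ {w : ℝ × ℝ | w.1 ≤ 2 * Real.log 2}
      · rw [indicator_of_mem hw]
        norm_num
      · rw [indicator_of_notMem hw]
        have hw' : 2 * Real.log 2 < w.1 := not_le.1 hw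
        have h2 : Real.exp (-(holdingTime q 0 w : ℝ)) ≤ 1 / 2 := by
          rw [coe_holdingTime hq (hl.trans hw'.le), totalRate, neg_zero, zpow_zero, Real.exp_neg,
            one_div]
          refine inv_anti₀ two_pos ?_
          rw [← Real.log_le_iff_le_exp two_pos]
          linarith
        norm_num
        linarith
    · rw [innovationLaw_real_fst_le hl, he]
      norm_num
  · refine key {w | w.2 < upProb q b} (measurableSet_lt measurable_snd measurable_const) ?_ ?_ ?_
    · rw [innovationLaw_real_snd_lt hu0 hu1]
      exact upProb_le_fifth hq hb
    · intro w hw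
      have hw' : w.2 < upProb q b := hw
      rw [zStep, if_pos hw']
      lia
    · intro w hw
      have hw' : ¬w.2 < upProb q b := hw
      rw [zStep, if_neg hw']
      lia

lemma lintegral_lyapunov (a : ℤ) (k : ℕ) :
    ∫⁻ ω, ENNReal.ofReal (Real.exp (-zTime q a ω k) * (11 / 10 : ℝ) ^ (zState q a ω k).natAbs)
        ∂iidLaw innovationLaw
      ≤ ENNReal.ofReal ((97 / 100) ^ k * (11 / 10 : ℝ) ^ a.natAbs) := by
  induction k with
  | zero => simp [zTime, zState, drivenChain]
  | succ k ih =>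
    let G : (ℤ × ℝ≥0) × (ℝ × ℝ) → ℝ≥0∞ := fun p => ENNReal.ofReal (Real.exp (-p.1.2))
      * ENNReal.ofReal (Real.exp (-holdingTime q p.1.1 p.2)
        * (11 / 10 : ℝ) ^ (zStep q p.1.1 p.2).natAbs)
    have hm1 : Measurable (fun p : ℤ × (ℝ × ℝ) => holdingTime q p.1 p.2) :=
      measurable_from_prod_countable_right (measurable_holdingTime q)
    have hm2 : Measurable (fun p : ℤ × (ℝ × ℝ) => zStep q p.1 p.2) :=
      measurable_from_prod_countable_right (measurable_zStep q)
    have hm3 : Measurable (fun p : (ℤ × ℝ≥0) × (ℝ × ℝ) => (p.1.1, p.2)) := by fun_prop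
    have hm4 : Measurable (fun b : ℤ => (11 / 10 : ℝ) ^ b.natAbs) := measurable_from_top
    have hG : Measurable G := by
      refine Measurable.mul (by fun_prop) (ENNReal.measurable_ofReal.comp (Measurable.mul ?_ ?_))
      · exact Real.measurable_exp.comp (measurable_coe_nnreal_real.comp (hm1.comp hm3)).neg
      · exact hm4.comp (hm2.comp hm3)
    have h := lintegral_innovation innovationLaw (k := k)
      (f := fun ω => (zState q a ω k, zTime q a ω k))
      ((measurable_zState q a k).prodMk (measurable_zTime q a k))
      (fun ω ω' h => Prod.ext (zState_congr q a h) (zTime_congr q a h)) hG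
    have e : ∀ ω : ℕ → ℝ × ℝ, ENNReal.ofReal (Real.exp (-zTime q a ω (k + 1))
        * (11 / 10 : ℝ) ^ (zState q a ω (k + 1)).natAbs)
        = G ((zState q a ω k, zTime q a ω k), ω k) := fun ω => by
      simp only [G]
      rw [← ENNReal.ofReal_mul (Real.exp_pos _).le, ← mul_assoc, ← Real.exp_add, zTime_succ,
        zState_succ, NNReal.coe_add, neg_add]
    simp only [e]
    rw [h]
    calc _ ≤ ∫⁻ ω, ENNReal.ofReal (97 / 100) * ENNReal.ofReal (Real.exp (-zTime q a ω k)
              * (11 / 10 : ℝ) ^ (zState q a ω k).natAbs) ∂iidLaw innovationLaw := by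
          refine lintegral_mono fun ω => ?_
          simp only [G]
          rw [lintegral_const_mul' _ _ ENNReal.ofReal_ne_top]
          refine (mul_le_mul_right (lintegral_lyapunov_step hq _) _).trans ?_
          rw [← ENNReal.ofReal_mul (Real.exp_pos _).le, ← ENNReal.ofReal_mul (by norm_num)]
          exact ENNReal.ofReal_le_ofReal (by ring_nf; rfl)
      _ ≤ _ := by
          rw [lintegral_const_mul' _ _ ENNReal.ofReal_ne_top]
          refine (mul_le_mul_right ih _).trans ?_
          rw [← ENNReal.ofReal_mul (by norm_num)]
          exact ENNReal.ofReal_le_ofReal (by rw [pow_succ]; ring_nf; rfl)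

/-- The `k`-th jump time is at least of order `k`, up to an exponentially small probability. -/
lemma measure_zTime_le (a : ℤ) (k : ℕ) (t : ℝ≥0) :
    iidLaw innovationLaw {ω | zTime q a ω k ≤ t}
      ≤ ENNReal.ofReal (Real.exp t * ((97 / 100) ^ k * (11 / 10 : ℝ) ^ a.natAbs)) := by
  have hsub : {ω | zTime q a ω k ≤ t} ⊆ {ω | ENNReal.ofReal (Real.exp (-t)) ≤
      ENNReal.ofReal (Real.exp (-zTime q a ω k) * (11 / 10 : ℝ) ^ (zState q a ω k).natAbs)} := by
    intro ω hω
    refine ENNReal.ofReal_le_ofReal ?_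
    have h1 : (1 : ℝ) ≤ (11 / 10 : ℝ) ^ (zState q a ω k).natAbs := one_le_pow₀ (by norm_num)
    have h2 : Real.exp (-t) ≤ Real.exp (-zTime q a ω k) :=
      Real.exp_le_exp.2 (neg_le_neg (NNReal.coe_le_coe.2 hω))
    exact h2.trans (le_mul_of_one_le_right (Real.exp_pos _).le h1)
  have hm4 : Measurable (fun b : ℤ => (11 / 10 : ℝ) ^ b.natAbs) := measurable_from_top
  have hmeas : Measurable fun ω => ENNReal.ofReal
      (Real.exp (-zTime q a ω k) * (11 / 10 : ℝ) ^ (zState q a ω k).natAbs) :=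
    ENNReal.measurable_ofReal.comp (Measurable.mul (Real.measurable_exp.comp
      (measurable_coe_nnreal_real.comp (measurable_zTime q a k)).neg)
      (hm4.comp (measurable_zState q a k)))
  have h := mul_meas_ge_le_lintegral (μ := iidLaw innovationLaw) hmeas
    (ENNReal.ofReal (Real.exp (-t)))
  calc iidLaw innovationLaw {ω | zTime q a ω k ≤ t}
      = ENNReal.ofReal (Real.exp t) * (ENNReal.ofReal (Real.exp (-t))
          * iidLaw innovationLaw {ω | zTime q a ω k ≤ t}) := by
        rw [← mul_assoc, ← ENNReal.ofReal_mul (Real.exp_pos _).le, ← Real.exp_add, add_neg_cancel,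
          Real.exp_zero, ENNReal.ofReal_one, one_mul]
    _ ≤ ENNReal.ofReal (Real.exp t)
          * ENNReal.ofReal ((97 / 100) ^ k * (11 / 10 : ℝ) ^ a.natAbs) := by
        refine mul_le_mul_right ?_ _
        exact ((mul_le_mul_right (measure_mono hsub) _).trans h).trans (lintegral_lyapunov hq a k)
    _ = _ := (ENNReal.ofReal_mul (Real.exp_pos _).le).symm

lemma ae_regularEvent (a : ℤ) : ∀ᵐ ω ∂iidLaw innovationLaw, ω ∈ regularEvent q a := by
  refine Filter.Eventually.and (ae_all_iff.2 fun i => ?_) (ae_all_iff.2 fun m => ?_)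
  · have hS : MeasurableSet {w : ℝ × ℝ | w.1 ≤ 0} := measurableSet_le measurable_fst measurable_const
    have h := iidLaw_innovation innovationLaw hS i
    have h0 := innovationLaw_real_fst_le le_rfl
    rw [neg_zero, Real.exp_zero, sub_self, measureReal_eq_zero_iff] at h0
    rw [h0] at h
    rw [ae_iff]
    simp only [not_lt]
    exact h
  · rw [ae_iff]
    have hlim : Tendsto (fun k : ℕ => ENNReal.ofReal
        (Real.exp (m : ℝ≥0) * ((97 / 100) ^ k * (11 / 10 : ℝ) ^ a.natAbs))) atTop (𝓝 0) := by
      rw [← ENNReal.ofReal_zero]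
      refine ENNReal.tendsto_ofReal ?_
      have := tendsto_pow_atTop_nhds_zero_of_lt_one (r := (97 / 100 : ℝ)) (by norm_num)
        (by norm_num)
      simpa using (this.mul_const ((11 / 10 : ℝ) ^ a.natAbs)).const_mul (Real.exp (m : ℝ≥0))
    refine le_antisymm (ge_of_tendsto' hlim fun k => ?_) zero_le
    refine (measure_mono fun ω hω => ?_).trans (measure_zTime_le hq a k m)
    simp only [not_exists, not_lt] at hω
    exact hω k

end Lyapunov

/-- The birth and death process is a continuous time Markov chain with the prescribed rates, on
every probability space that carries its innovations. -/
theorem isContinuousTimeMarkovChain_zPath {q : ℝ} (hq : 2 ≤ q) (a : ℤ) {Ω : Type*}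
    [MeasurableSpace Ω] {μ : Measure Ω} {f : Ω → ℕ → ℝ × ℝ}
    (hf : MeasurePreserving f μ (iidLaw innovationLaw)) :
    IsContinuousTimeMarkovChain (birthDeathRate q) (fun t ω => zPath q a t (f ω)) μ where
  measurable t := (measurable_zPath q a t).comp hf.measurable
  rightContinuous ω := zPath_rightContinuous q a (f ω)
  nonExplosive := by
    filter_upwards [hf.quasiMeasurePreserving.ae (ae_regularEvent hq a)] with ω hω
    simp only [(jumpTime_zPath a hq hω _).1]
    refine ENNReal.tendsto_nhds_top fun n => ?_
    obtain ⟨k, hk⟩ := hω.2 n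
    filter_upwards [eventually_ge_atTop k] with i hi
    exact_mod_cast hk.trans_le (zTime_monotone q a _ hi)
  transition k x s := by
    have hm : Measurable (fun p : ℤ × (ℝ × ℝ) => holdingTime q p.1 p.2) :=
      measurable_from_prod_countable_right (measurable_holdingTime q)
    have hH : ∀ k, MeasurableSet {ω | (∀ i ≤ k, zState q a ω i = x i) ∧
        ∀ i < k, s i < holdingTime q (zState q a ω i) (ω i)} := fun k => by
      have e : {ω | (∀ i ≤ k, zState q a ω i = x i) ∧
          ∀ i < k, s i < holdingTime q (zState q a ω i) (ω i)}
          = (⋂ i, ⋂ (_ : i ≤ k), {ω | zState q a ω i = x i})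
            ∩ ⋂ i, ⋂ (_ : i < k), {ω | s i < holdingTime q (zState q a ω i) (ω i)} := by
        ext ω
        simp
      rw [e]
      refine .inter (.iInter fun i => .iInter fun _ => ?_) (.iInter fun i => .iInter fun _ => ?_)
      · exact measurable_zState q a i (measurableSet_singleton _)
      · exact measurableSet_lt measurable_const
          (hm.comp ((measurable_zState q a i).prodMk (measurable_pi_apply i)))
    have hr : ∀ k : ℕ, μ.real
        {ω | (∀ i ≤ k, embeddedChain (fun t => zPath q a t (f ω)) i = x i) ∧
          ∀ i < k, (s i : ℝ≥0∞) < jumpTime (fun t => zPath q a t (f ω)) (i + 1)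
            - jumpTime (fun t => zPath q a t (f ω)) i}
        = (iidLaw innovationLaw).real {ω | (∀ i ≤ k, zState q a ω i = x i) ∧
          ∀ i < k, s i < holdingTime q (zState q a ω i) (ω i)} := fun k => by
      rw [← hf.measureReal_preimage (hH k).nullMeasurableSet]
      refine measureReal_congr ?_
      filter_upwards [hf.quasiMeasurePreserving.ae (ae_regularEvent hq a)] with ω hω
      refine propext (and_congr (forall₂_congr fun i _ => ?_) (forall₂_congr fun i _ => ?_))
      · rw [(jumpTime_zPath a hq hω _).2]
      · rw [(jumpTime_zPath a hq hω _).1, (jumpTime_zPath a hq hω _).1, ← ENNReal.coe_sub,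
          zTime_succ, add_tsub_cancel_left, ENNReal.coe_lt_coe]
    rw [hr, hr]
    have hB : MeasurableSet {w | s k < holdingTime q (x k) w ∧ zStep q (x k) w = x (k + 1)} :=
      (measurableSet_lt measurable_const (measurable_holdingTime q _)).inter
        (measurable_zStep q _ (measurableSet_singleton _))
    have hd : DependsOn (fun ω => ω ∈ {ω | (∀ i ≤ k, zState q a ω i = x i) ∧
        ∀ i < k, s i < holdingTime q (zState q a ω i) (ω i)}) (Iio k) := by
      intro ω ω' h
      have hs : ∀ i ≤ k, zState q a ω i = zState q a ω' i := fun i hi =>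
        zState_congr q a fun j hj => h j (lt_of_lt_of_le hj hi)
      refine propext (and_congr (forall₂_congr fun i hi => ?_) (forall₂_congr fun i hi => ?_))
      · rw [hs i hi]
      · rw [hs i hi.le, h i hi]
    have hmul := iidLaw_real_inter innovationLaw (hH k) hd hB
    have hset : {ω | (∀ i ≤ k + 1, zState q a ω i = x i) ∧
        ∀ i < k + 1, s i < holdingTime q (zState q a ω i) (ω i)}
        = {ω | (∀ i ≤ k, zState q a ω i = x i) ∧
          ∀ i < k, s i < holdingTime q (zState q a ω i) (ω i)} ∩ {ω | ω k ∈
          {w | s k < holdingTime q (x k) w ∧ zStep q (x k) w = x (k + 1)}} := by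
      ext ω
      constructor
      · rintro ⟨h1, h2⟩
        refine ⟨⟨fun i hi => h1 i (by lia), fun i hi => h2 i (by lia)⟩, ?_, ?_⟩
        · rw [← h1 k (by lia)]
          exact h2 k (by lia)
        · rw [← h1 k (by lia)]
          exact h1 (k + 1) le_rfl
      · rintro ⟨⟨h1, h2⟩, h3, h4⟩
        refine ⟨fun i hi => ?_, fun i hi => ?_⟩
        · rcases Nat.le_succ_iff.1 hi with hi | rfl
          · exact h1 i hi
          · rw [zState_succ, h1 k le_rfl]
            exact h4
        · rcases Nat.lt_succ_iff_lt_or_eq.1 hi with hi | rfl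
          · exact h2 i hi
          · rw [h1 i le_rfl]
            exact h3
    rw [hset, hmul]
    congr 1
    -- The law of a single step.
    have hR := totalRate_pos hq (x k)
    have hs0 : 0 ≤ (s k : ℝ) * totalRate q (x k) := by positivity
    have hwait : ∀ w : ℝ × ℝ, s k < holdingTime q (x k) w ↔ (s k : ℝ) * totalRate q (x k) < w.1 :=
      fun w => by rw [holdingTime, Real.lt_toNNReal_iff_coe_lt, lt_div_iff₀ hR]
    have hdiag : birthDeathRate q (x k) (x k) = -totalRate q (x k) := by
      rw [birthDeathRate, if_neg (by lia), if_neg (by lia), if_pos rfl, totalRate]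
      ring
    have hexp : Real.exp (birthDeathRate q (x k) (x k) * s k)
        = Real.exp (-(s k * totalRate q (x k))) := by rw [hdiag]; ring_nf
    have hu0 := upProb_nonneg hq (x k)
    have hu1 := upProb_le_one hq (x k)
    simp only [hwait]
    rw [hexp, ← expMeasure_real_Ioi hs0, jumpMatrix, hdiag, neg_neg]
    by_cases h1 : x (k + 1) = x k + 1
    · have e : {w : ℝ × ℝ | s k * totalRate q (x k) < w.1 ∧ zStep q (x k) w = x (k + 1)}
          = Ioi (s k * totalRate q (x k)) ×ˢ Iio (upProb q (x k)) := by
        ext w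
        refine and_congr Iff.rfl ?_
        rw [zStep, h1]
        split_ifs with h
        · exact iff_of_true rfl h
        · exact iff_of_false (by lia) h
      rw [e, innovationLaw_real_prod, uniform_real_Iio hu0 hu1, if_neg (by lia), birthDeathRate,
        if_pos h1, upProb]
    · by_cases h2 : x (k + 1) = x k - 1
      · have e : {w : ℝ × ℝ | s k * totalRate q (x k) < w.1 ∧ zStep q (x k) w = x (k + 1)}
            = Ioi (s k * totalRate q (x k)) ×ˢ Ici (upProb q (x k)) := by
          ext w
          refine and_congr Iff.rfl ?_
          rw [zStep, h2]
          split_ifs with h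
          · exact iff_of_false (by lia) (not_le.2 h)
          · exact iff_of_true rfl (not_lt.1 h)
        rw [e, innovationLaw_real_prod, uniform_real_Ici hu0 hu1, if_neg (by lia), birthDeathRate,
          if_neg (by lia), if_pos h2, one_sub_upProb hq]
      · have e : {w : ℝ × ℝ | s k * totalRate q (x k) < w.1 ∧ zStep q (x k) w = x (k + 1)}
            = ∅ := by
          ext w
          simp only [mem_ofPred_eq, mem_empty_iff_false, iff_false, not_and]
          intro _
          rw [zStep]
          split_ifs <;> lia
        rw [e, measureReal_empty]
        split_ifs with h3
        · rw [mul_zero]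
        · rw [birthDeathRate, if_neg h1, if_neg h2, if_neg h3, zero_div, mul_zero]

/-! ### Two-step transition probabilities of the rank increments -/

/-- The state of the rank chain on `{0, …, n}` that the integer `j` stands for; integers outside
this range are clamped. -/
def toState (n : ℕ) (j : ℤ) : Fin (n + 1) :=
  ⟨min j.toNat n, Nat.lt_succ_of_le (min_le_right _ _)⟩

lemma coe_toState {n : ℕ} {j : ℤ} (h0 : 0 ≤ j) (h1 : j ≤ n) : ((toState n j : ℕ) : ℤ) = j := by
  simp only [toState]
  lia

lemma toState_injective {n : ℕ} {i j : ℤ} (hi0 : 0 ≤ i) (hi1 : i ≤ n) (hj0 : 0 ≤ j) (hj1 : j ≤ n)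
    (h : toState n i = toState n j) : i = j := by
  rw [← coe_toState hi0 hi1, ← coe_toState hj0 hj1, h]

/-- The length of the time interval in which the rescaled process makes a single step, for
`n = 2 * m`. -/
noncomputable def stepSize (q : ℝ) (m : ℕ) : ℝ := q ^ (-(m : ℤ)) / (q - 1)

section TwoSteps

variable {q : ℝ} (hq : 2 ≤ q)
include hq

lemma stepSize_pos (m : ℕ) : 0 < stepSize q m := by
  have : 0 < q := by linarith
  exact div_pos (by positivity) (by linarith)

lemma zpow_div_sub_one (m : ℕ) (b : ℤ) :
    q ^ (-((m : ℤ) + b)) / (q - 1) = stepSize q m * q ^ (-b) := by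
  have : q ≠ 0 := by linarith
  rw [stepSize, neg_add, zpow_add₀ this]
  ring

variable {m n : ℕ} (hn : n = 2 * m) {b : ℤ} (hb : |b| < m)
include hn hb

lemma two_step_stay_ge :
    1 - stepSize q m * totalRate q b
      ≤ rankTransition q n (toState n (m + b)) (toState n (m - b))
        * rankTransition q n (toState n (m - b)) (toState n (m + b)) := by
  have hq1 : 1 < q := by linarith
  rw [abs_lt] at hb
  have c1 := coe_toState (n := n) (j := m + b) (by lia) (by lia)
  have c2 := coe_toState (n := n) (j := m - b) (by lia) (by lia)
  have h1 := rankTransition_full_ge hq1 (toState n (m + b)) (toState n (m - b)) (by omega)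
  have h2 := rankTransition_full_ge hq1 (toState n (m - b)) (toState n (m + b)) (by omega)
  have p1 := rankTransition_nonneg hq1 (toState n (m + b)) (toState n (m - b))
  have p2 := rankTransition_nonneg hq1 (toState n (m - b)) (toState n (m + b))
  rw [c1, zpow_div_sub_one hq] at h1
  have hz := zpow_div_sub_one hq m (-b)
  rw [neg_neg, ← sub_eq_add_neg] at hz
  rw [c2, hz] at h2
  rw [totalRate]
  have hδ := stepSize_pos hq m
  have hu : 0 ≤ stepSize q m * q ^ (-b) := by positivity
  have hv : 0 ≤ stepSize q m * q ^ b := by positivity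
  set x := rankTransition q n (toState n (m + b)) (toState n (m - b))
  set y := rankTransition q n (toState n (m - b)) (toState n (m + b))
  by_cases hx : stepSize q m * q ^ (-b) ≤ 1
  · nlinarith
  · nlinarith [mul_nonneg p1 p2]

variable {w : ℝ} (hw : w ≤ 1 / 4) (hw1 : q ^ (-((m : ℤ) + b)) ≤ w) (hw2 : q ^ (-((m : ℤ) - b)) ≤ w)
include hw hw1 hw2

lemma two_step_up_ge :
    stepSize q m * q ^ (-b) * (1 - 4 * w)
      ≤ rankTransition q n (toState n (m + b)) (toState n (m - b - 1))
        * rankTransition q n (toState n (m - b - 1)) (toState n (m + (b + 1))) := by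
  have hq1 : 1 < q := by linarith
  rw [abs_lt] at hb
  have c1 := coe_toState (n := n) (j := m + b) (by lia) (by lia)
  have c2 := coe_toState (n := n) (j := m - b - 1) (by lia) (by lia)
  have c3 := coe_toState (n := n) (j := m + (b + 1)) (by lia) (by lia)
  have h1 := rankTransition_corank_one_ge hq (toState n (m + b)) (toState n (m - b - 1)) (by omega)
  have h2 := rankTransition_full_ge hq1 (toState n (m - b - 1)) (toState n (m + (b + 1))) (by omega)
  rw [c1, zpow_div_sub_one hq, show (n : ℤ) - (m + b) = m - b by lia] at h1
  have e : q ^ (-((m : ℤ) - b - 1)) = q ^ (-((m : ℤ) - b)) * q := by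
    rw [← zpow_add_one₀ (by linarith)]; ring_nf
  rw [c2, e] at h2
  have hδ := stepSize_pos hq m
  have hu : 0 ≤ stepSize q m * q ^ (-b) := by positivity
  have hv : 0 ≤ q ^ (-((m : ℤ) - b)) := by positivity
  have h3 : q ^ (-((m : ℤ) - b)) * q / (q - 1) ≤ 2 * w := by
    rw [div_le_iff₀ (by linarith)]
    nlinarith
  calc stepSize q m * q ^ (-b) * (1 - 4 * w)
      ≤ stepSize q m * q ^ (-b) * ((1 - w - w) * (1 - 2 * w)) :=
        mul_le_mul_of_nonneg_left (by nlinarith) hu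
    _ = (stepSize q m * q ^ (-b) * (1 - w - w)) * (1 - 2 * w) := by ring
    _ ≤ _ := by
        refine mul_le_mul (le_trans ?_ h1) (by linarith) (by linarith)
          (rankTransition_nonneg hq1 _ _)
        exact mul_le_mul_of_nonneg_left (by linarith) hu

lemma two_step_down_ge :
    stepSize q m * q ^ b * (1 - 4 * w)
      ≤ rankTransition q n (toState n (m + b)) (toState n (m - b))
        * rankTransition q n (toState n (m - b)) (toState n (m + (b - 1))) := by
  have hq1 : 1 < q := by linarith
  rw [abs_lt] at hb
  have c1 := coe_toState (n := n) (j := m + b) (by lia) (by lia)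
  have c2 := coe_toState (n := n) (j := m - b) (by lia) (by lia)
  have c3 := coe_toState (n := n) (j := m + (b - 1)) (by lia) (by lia)
  have h1 := rankTransition_full_ge hq1 (toState n (m + b)) (toState n (m - b)) (by omega)
  have h2 := rankTransition_corank_one_ge hq (toState n (m - b)) (toState n (m + (b - 1))) (by omega)
  have hz := zpow_div_sub_one hq m (-b)
  rw [neg_neg, ← sub_eq_add_neg] at hz
  rw [c2, hz, show (n : ℤ) - (m - b) = m + b by lia] at h2
  rw [c1] at h1
  have hδ := stepSize_pos hq m
  have hu : 0 ≤ stepSize q m * q ^ b := by positivity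
  have hv : 0 ≤ q ^ (-((m : ℤ) + b)) := by positivity
  have h3 : q ^ (-((m : ℤ) + b)) / (q - 1) ≤ w := by
    rw [div_le_iff₀ (by linarith)]
    nlinarith
  calc stepSize q m * q ^ b * (1 - 4 * w)
      ≤ stepSize q m * q ^ b * ((1 - w) * (1 - w - w)) :=
        mul_le_mul_of_nonneg_left (by nlinarith) hu
    _ = (1 - w) * (stepSize q m * q ^ b * (1 - w - w)) := by ring
    _ ≤ _ := by
        refine mul_le_mul (by linarith) (le_trans ?_ h2) (mul_nonneg hu (by linarith))
          (rankTransition_nonneg hq1 _ _)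
        exact mul_le_mul_of_nonneg_left (by linarith) hu

end TwoSteps

/-! ### Skeletons -/

/-- The state reached by a skeleton started at `a`. A skeleton is a list of jumps, the last jump
being the head of the list; the entry `(g, u)` stands for an upward (`u = true`) or downward jump
after `g` double steps without a jump. -/
def endState (a : ℤ) : List (ℕ × Bool) → ℤ
  | [] => a
  | (_, u) :: l => endState a l + if u then 1 else -1

/-- The number of double steps of a skeleton. -/
def duration : List (ℕ × Bool) → ℕ
  | [] => 0
  | (g, _) :: l => duration l + (g + 1)

/-- The path `p`, which ends in the state `b`, continued by `g` double steps from `b` to `b`. -/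
def stayPath (n m : ℕ) (b : ℤ) : ℕ → List (Fin (n + 1)) → List (Fin (n + 1))
  | 0, p => p
  | g + 1, p => toState n (m + b) :: toState n (m - b) :: stayPath n m b g p

/-- The most likely path of the rank chain with a given skeleton, with its intermediate states
at odd times. -/
def skeletonPath (n m : ℕ) (a : ℤ) : List (ℕ × Bool) → List (Fin (n + 1))
  | [] => [toState n (m + a)]
  | (g, u) :: l =>
    toState n (m + endState a ((g, u) :: l))
      :: toState n (if u then m - endState a l - 1 else m - endState a l)
      :: stayPath n m (endState a l) g (skeletonPath n m a l)

/-- The innovations for which the birth and death process jumps from `b` in the direction `u`, at a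
time in the `g`-th interval of length `δ`. -/
def innovationCell (q δ : ℝ) (b : ℤ) (g : ℕ) (u : Bool) : Set (ℝ × ℝ) :=
  Ioc (g * (δ * totalRate q b)) ((g + 1) * (δ * totalRate q b))
    ×ˢ if u then Iio (upProb q b) else Ici (upProb q b)

/-- The event that the birth and death process has a given skeleton. -/
def skeletonEvent (q δ : ℝ) (a : ℤ) : List (ℕ × Bool) → Set (ℕ → ℝ × ℝ)
  | [] => univ
  | (g, u) :: l =>
    skeletonEvent q δ a l ∩ {ω | ω l.length ∈ innovationCell q δ (endState a l) g u}

/-- Skeletons that start all their jumps in `[-L, L]`, and whose holding times, relative to their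
means, are at most `s`. -/
def IsTame (q δ : ℝ) (a L : ℤ) (s : ℝ) : List (ℕ × Bool) → Prop
  | [] => True
  | (g, _) :: l => IsTame q δ a L s l ∧ |endState a l| ≤ L
      ∧ g * (δ * totalRate q (endState a l)) ≤ s

section SkeletonEvent

lemma measurableSet_innovationCell (q δ : ℝ) (b : ℤ) (g : ℕ) (u : Bool) :
    MeasurableSet (innovationCell q δ b g u) := by
  refine measurableSet_Ioc.prod ?_
  cases u
  · exact measurableSet_Ici
  · exact measurableSet_Iio

lemma zStep_of_mem_innovationCell {q δ : ℝ} {b : ℤ} {g : ℕ} {u : Bool} {w : ℝ × ℝ}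
    (h : w ∈ innovationCell q δ b g u) : zStep q b w = b + if u then 1 else -1 := by
  have h2 := h.2
  cases u
  · rw [zStep, if_neg (not_lt.2 h2)]; rfl
  · have h3 : w.2 < upProb q b := h2
    rw [zStep, if_pos h3]; rfl

lemma zState_of_mem_skeletonEvent {q δ : ℝ} {a : ℤ} {l : List (ℕ × Bool)} {ω : ℕ → ℝ × ℝ}
    (h : ω ∈ skeletonEvent q δ a l) : zState q a ω l.length = endState a l := by
  induction l with
  | nil => rfl
  | cons p l ih =>
    obtain ⟨g, u⟩ := p
    rw [List.length_cons, zState_succ, ih h.1, zStep_of_mem_innovationCell h.2, endState]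

lemma measurableSet_skeletonEvent (q δ : ℝ) (a : ℤ) (l : List (ℕ × Bool)) :
    MeasurableSet (skeletonEvent q δ a l) := by
  induction l with
  | nil => exact .univ
  | cons p l ih =>
    obtain ⟨g, u⟩ := p
    exact ih.inter (measurable_pi_apply l.length (measurableSet_innovationCell q δ _ g u))

lemma skeletonEvent_dependsOn (q δ : ℝ) (a : ℤ) (l : List (ℕ × Bool)) :
    DependsOn (fun ω => ω ∈ skeletonEvent q δ a l) (Iio l.length) := by
  induction l with
  | nil => intro ω ω' _; rfl
  | cons p l ih =>
    obtain ⟨g, u⟩ := p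
    intro ω ω' h
    have h1 := ih fun i hi => h i (lt_trans hi (Nat.lt_succ_self _))
    have h2 := h l.length (Nat.lt_succ_self _)
    simp only [skeletonEvent, mem_inter_iff, mem_ofPred_eq, h2]
    exact congrArg (· ∧ _) h1

lemma skeletonEvent_real_cons (q δ : ℝ) (a : ℤ) (g : ℕ) (u : Bool) (l : List (ℕ × Bool)) :
    (iidLaw innovationLaw).real (skeletonEvent q δ a ((g, u) :: l))
      = (iidLaw innovationLaw).real (skeletonEvent q δ a l)
        * innovationLaw.real (innovationCell q δ (endState a l) g u) :=
  iidLaw_real_inter innovationLaw (measurableSet_skeletonEvent q δ a l)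
    (skeletonEvent_dependsOn q δ a l) (measurableSet_innovationCell q δ _ g u)

variable {q δ : ℝ} (hq : 2 ≤ q) (hδ : 0 < δ)
include hq hδ

lemma skeletonEvent_injective {a : ℤ} {l l' : List (ℕ × Bool)} (hl : l.length = l'.length)
    {ω : ℕ → ℝ × ℝ} (h : ω ∈ skeletonEvent q δ a l) (h' : ω ∈ skeletonEvent q δ a l') :
    l = l' := by
  induction l generalizing l' with
  | nil => exact (List.length_eq_zero_iff.1 hl.symm).symm
  | cons p l ih =>
    match l' with
    | [] => simp at hl
    | p' :: l' =>
      obtain ⟨g, u⟩ := p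
      obtain ⟨g', u'⟩ := p'
      have hll : l.length = l'.length := by simpa using hl
      obtain rfl := ih hll h.1 h'.1
      have hx : 0 < δ * totalRate q (endState a l) := mul_pos hδ (totalRate_pos hq _)
      have c := h.2
      have c' := h'.2
      have hg : ∀ {i j : ℕ} {E : ℝ}, i * (δ * totalRate q (endState a l)) < E →
          E ≤ (j + 1) * (δ * totalRate q (endState a l)) → i ≤ j := by
        intro i j E h1 h2
        have h3 := lt_of_mul_lt_mul_right (h1.trans_le h2) hx.le
        have h4 : i < j + 1 := by exact_mod_cast h3
        lia
      obtain rfl : g = g' := le_antisymm (hg c.1.1 c'.1.2) (hg c'.1.1 c.1.2)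
      have hu : (if u then (1 : ℤ) else -1) = if u' then 1 else -1 := by
        have := zStep_of_mem_innovationCell c
        rw [zStep_of_mem_innovationCell c'] at this
        lia
      cases u <;> cases u' <;> simp_all

/-- The probability of a cell is at most its length times the value of the density at its left
end. -/
lemma innovationLaw_real_cell_le (b : ℤ) (g : ℕ) (u : Bool) :
    innovationLaw.real (innovationCell q δ b g u)
      ≤ Real.exp (-(g * (δ * totalRate q b))) * (δ * if u then q ^ (-b) else q ^ b) := by
  have hR := totalRate_pos hq b
  have hx : 0 < δ * totalRate q b := mul_pos hδ hR
  have hu : ((volume : Measure ℝ).restrict (Icc 0 1)).real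
      (if u then Iio (upProb q b) else Ici (upProb q b))
      = (if u then q ^ (-b) else q ^ b) / totalRate q b := by
    cases u
    · simp only [Bool.false_eq_true, if_false]
      rw [uniform_real_Ici (upProb_nonneg hq b) (upProb_le_one hq b), one_sub_upProb hq]
    · simp only [if_true]
      rw [uniform_real_Iio (upProb_nonneg hq b) (upProb_le_one hq b), upProb]
  have hE : (ProbabilityTheory.expMeasure 1).real
      (Ioc (g * (δ * totalRate q b)) ((g + 1) * (δ * totalRate q b)))
      ≤ Real.exp (-(g * (δ * totalRate q b))) * (δ * totalRate q b) := by
    have h1 : g * (δ * totalRate q b) ≤ (g + 1) * (δ * totalRate q b) := by nlinarith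
    rw [← Ioi_sdiff_Ioi, measureReal_sdiff (Ioi_subset_Ioi h1) measurableSet_Ioi,
      expMeasure_real_Ioi (by positivity), expMeasure_real_Ioi (by positivity), add_mul, one_mul,
      neg_add, Real.exp_add]
    have h2 := Real.add_one_le_exp (-(δ * totalRate q b))
    have h3 := Real.exp_pos (-(g * (δ * totalRate q b)))
    nlinarith
  have hq0 : 0 < q := by linarith
  rw [innovationCell, innovationLaw_real_prod, hu]
  calc _ ≤ Real.exp (-(g * (δ * totalRate q b))) * (δ * totalRate q b)
        * ((if u then q ^ (-b) else q ^ b) / totalRate q b) :=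
        mul_le_mul_of_nonneg_right hE (by split_ifs <;> positivity)
    _ = _ := by field_simp

/-- Innovations with bounded holding times and no jump out of `[-L, L]` have a tame skeleton. -/
lemma exists_isTame {a L : ℤ} (ha : |a| ≤ L) {s : ℝ} {ω : ℕ → ℝ × ℝ} {N : ℕ}
    (h : ∀ i < N, 0 < (ω i).1 ∧ (ω i).1 ≤ s ∧ upProb q L ≤ (ω i).2 ∧ (ω i).2 < upProb q (-L)) :
    ∃ l : List (ℕ × Bool), l.length = N ∧ IsTame q δ a L s l ∧ |endState a l| ≤ L
      ∧ ω ∈ skeletonEvent q δ a l := by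
  classical
  induction N with
  | zero => exact ⟨[], rfl, trivial, ha, trivial⟩
  | succ N ih =>
    obtain ⟨l, hl, ht, hL, hω⟩ := ih fun i hi => h i (by lia)
    obtain ⟨h0, hs, hd, hu⟩ := h N (Nat.lt_succ_self N)
    set b := endState a l
    have hx : 0 < δ * totalRate q b := mul_pos hδ (totalRate_pos hq _)
    -- The cell of the holding time is determined by rounding up.
    have hg0 : 0 < ⌈(ω N).1 / (δ * totalRate q b)⌉₊ := Nat.ceil_pos.2 (div_pos h0 hx)
    obtain ⟨g, hg⟩ := Nat.exists_eq_succ_of_ne_zero hg0.ne'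
    have hg1 : g * (δ * totalRate q b) < (ω N).1 := by
      rw [← lt_div_iff₀ hx]
      exact Nat.lt_ceil.1 (by lia)
    have hg2 : (ω N).1 ≤ (g + 1) * (δ * totalRate q b) := by
      rw [← div_le_iff₀ hx]
      have := Nat.le_ceil ((ω N).1 / (δ * totalRate q b))
      rw [hg] at this
      exact_mod_cast this
    rw [abs_le] at hL
    by_cases hdir : (ω N).2 < upProb q b
    · refine ⟨(g, true) :: l, by simp [hl], ⟨ht, abs_le.2 hL, (hg1.trans_le hs).le⟩, ?_, hω, ?_⟩
      · have : b ≠ L := fun hb => absurd hdir (not_lt.2 (hb ▸ hd))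
        rw [abs_le, endState]
        simp only [if_true]
        lia
      · rw [mem_ofPred_eq, hl]
        exact ⟨⟨hg1, hg2⟩, hdir⟩
    · refine ⟨(g, false) :: l, by simp [hl], ⟨ht, abs_le.2 hL, (hg1.trans_le hs).le⟩, ?_, hω, ?_⟩
      · have : b ≠ -L := fun hb => absurd hu (hb ▸ hdir)
        rw [abs_le, endState]
        simp only [Bool.false_eq_true, if_false]
        lia
      · rw [mem_ofPred_eq, hl]
        exact ⟨⟨hg1, hg2⟩, not_lt.1 hdir⟩

end SkeletonEvent

section SkeletonPath

variable {n m : ℕ}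

lemma exists_stayPath_eq_cons {b : ℤ} {p : List (Fin (n + 1))}
    (hp : ∃ t, p = toState n (m + b) :: t) (g : ℕ) :
    ∃ t, stayPath n m b g p = toState n (m + b) :: t := by
  cases g with
  | zero => exact hp
  | succ g => exact ⟨_, rfl⟩

lemma exists_skeletonPath_eq_cons (a : ℤ) (l : List (ℕ × Bool)) :
    ∃ t, skeletonPath n m a l = toState n (m + endState a l) :: t := by
  cases l with
  | nil => exact ⟨_, rfl⟩
  | cons p l => exact ⟨_, rfl⟩

lemma length_stayPath (b : ℤ) (g : ℕ) (p : List (Fin (n + 1))) :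
    (stayPath n m b g p).length = p.length + 2 * g := by
  induction g with
  | zero => rfl
  | succ g ih => simp only [stayPath, List.length_cons, ih]; lia

lemma length_skeletonPath (a : ℤ) (l : List (ℕ × Bool)) :
    (skeletonPath n m a l).length = 2 * duration l + 1 := by
  induction l with
  | nil => rfl
  | cons p l ih =>
    simp only [skeletonPath, List.length_cons, length_stayPath, ih, duration]
    lia

variable {Ω : Type*} {X : ℕ → Ω → Fin (n + 1)}

lemma of_mem_pathEvent_stayPath {b : ℤ} {t : List (Fin (n + 1))} {k g : ℕ}
    (ht : t.length = 2 * k) {ω : Ω}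
    (h : ω ∈ pathEvent X (stayPath n m b g (toState n (m + b) :: t))) :
    ω ∈ pathEvent X (toState n (m + b) :: t)
      ∧ ∀ j, k ≤ j → j ≤ k + g → X (2 * j) ω = toState n (m + b) := by
  induction g with
  | zero =>
    refine ⟨h, fun j h1 h2 => ?_⟩
    obtain rfl : j = k := by lia
    rw [← ht]
    exact h.2
  | succ g ih =>
    obtain ⟨⟨h1, -⟩, h3⟩ := h
    obtain ⟨i1, i2⟩ := ih h1
    refine ⟨i1, fun j h4 h5 => ?_⟩
    rcases h5.lt_or_eq with h6 | rfl
    · exact i2 j h4 (by lia)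
    · have h7 : X ((stayPath n m b g (toState n (m + b) :: t)).length + 1) ω = toState n (m + b) :=
        h3
      rw [length_stayPath, List.length_cons, ht] at h7
      rw [← h7]
      congr 1
      lia

/-- The states at even times on the event that the rank chain follows a skeleton. -/
lemma of_mem_pathEvent_skeletonPath {a : ℤ} {g : ℕ} {u : Bool} {l : List (ℕ × Bool)} {ω : Ω}
    (h : ω ∈ pathEvent X (skeletonPath n m a ((g, u) :: l))) :
    ω ∈ pathEvent X (skeletonPath n m a l)
      ∧ (∀ j, duration l ≤ j → j < duration ((g, u) :: l) →
          X (2 * j) ω = toState n (m + endState a l))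
      ∧ X (2 * duration ((g, u) :: l)) ω = toState n (m + endState a ((g, u) :: l)) := by
  obtain ⟨t, ht⟩ := exists_skeletonPath_eq_cons (n := n) (m := m) a l
  have hlen := length_skeletonPath (n := n) (m := m) a l
  obtain ⟨⟨h1, -⟩, h3⟩ := h
  have h4 : X ((stayPath n m (endState a l) g (skeletonPath n m a l)).length + 1) ω
      = toState n (m + endState a ((g, u) :: l)) := h3
  rw [length_stayPath, hlen] at h4
  rw [ht, List.length_cons] at hlen
  rw [ht] at h1
  obtain ⟨i1, i2⟩ := of_mem_pathEvent_stayPath (k := duration l) (by lia) h1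
  refine ⟨by rw [ht]; exact i1, fun j h5 h6 => i2 j h5 ?_, ?_⟩
  · rw [duration] at h6
    lia
  · rw [← h4, duration]
    congr 1
    lia

lemma skeletonPath_injective (hn : n = 2 * m) {q δ s : ℝ} {a L : ℤ} (hL : L < m)
    {l l' : List (ℕ × Bool)} (hl : l.length = l'.length) (ht : IsTame q δ a L s l)
    (ht' : IsTame q δ a L s l') {ω : Ω} (h : ω ∈ pathEvent X (skeletonPath n m a l))
    (h' : ω ∈ pathEvent X (skeletonPath n m a l')) : l = l' := by
  induction l generalizing l' with
  | nil => exact (List.length_eq_zero_iff.1 hl.symm).symm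
  | cons p l ih =>
    match l' with
    | [] => simp at hl
    | p' :: l' =>
      obtain ⟨g, u⟩ := p
      obtain ⟨g', u'⟩ := p'
      have hll : l.length = l'.length := by simpa using hl
      obtain ⟨j1, j2, j3⟩ := of_mem_pathEvent_skeletonPath h
      obtain ⟨j1', j2', j3'⟩ := of_mem_pathEvent_skeletonPath h'
      obtain rfl := ih hll ht.1 ht'.1 j1 j1'
      have hb := abs_le.1 ht.2.1
      -- A jump moves the state, so that it cannot happen while the other skeleton stays.
      have key : ∀ v : Bool, toState n (m + (endState a l + if v then 1 else -1))
          ≠ toState n (m + endState a l) := fun v hv => by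
        have := toState_injective (by split_ifs <;> lia) (by split_ifs <;> lia) (by lia) (by lia) hv
        split_ifs at this <;> lia
      rw [duration] at j2 j3 j2' j3'
      rw [endState] at j3 j3'
      obtain rfl : g = g' := by
        rcases lt_trichotomy g g' with hg | hg | hg
        · exact absurd (j3.symm.trans (j2' _ (by lia) (by lia))) (key u)
        · exact hg
        · exact absurd (j3'.symm.trans (j2 _ (by lia) (by lia))) (key u')
      have hu := toState_injective (by split_ifs <;> lia) (by split_ifs <;> lia)
        (by split_ifs <;> lia) (by split_ifs <;> lia) (j3.symm.trans j3')
      cases u <;> cases u' <;> simp_all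

end SkeletonPath

/-! ### Comparison of the skeletons of the two processes -/

/-- A geometric holding time dominates the discretized exponential holding time with the same
rate, up to a factor close to one. -/
lemma exp_mul_le_one_sub_pow {x s : ℝ} {g : ℕ} (h0 : 0 ≤ x) (h1 : x ≤ 1) (hs : g * x ≤ s) :
    (1 - s * x) * Real.exp (-(g * x)) ≤ (1 - x) ^ g := by
  have h2 : (1 - x ^ 2) * Real.exp (-x) ≤ 1 - x := by
    have h3 : 1 + x ≤ Real.exp x := by linarith [Real.add_one_le_exp x]
    have h4 : (1 + x) * Real.exp (-x) ≤ 1 := by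
      calc (1 + x) * Real.exp (-x) ≤ Real.exp x * Real.exp (-x) :=
            mul_le_mul_of_nonneg_right h3 (Real.exp_pos _).le
        _ = 1 := by rw [← Real.exp_add, add_neg_cancel, Real.exp_zero]
    nlinarith
  have h5 : 1 - s * x ≤ (1 - x ^ 2) ^ g := by
    have h6 := one_add_mul_le_pow (a := -x ^ 2) (by nlinarith) g
    rw [← sub_eq_add_neg] at h6
    nlinarith
  have h7 : Real.exp (-(g * x)) = Real.exp (-x) ^ g := by
    rw [← Real.exp_nat_mul]; ring_nf
  calc (1 - s * x) * Real.exp (-(g * x)) ≤ (1 - x ^ 2) ^ g * Real.exp (-x) ^ g := by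
        rw [h7]
        exact mul_le_mul_of_nonneg_right h5 (by positivity)
    _ = ((1 - x ^ 2) * Real.exp (-x)) ^ g := (mul_pow _ _ _).symm
    _ ≤ (1 - x) ^ g := pow_le_pow_left₀ (mul_nonneg (by nlinarith) (Real.exp_pos _).le) h2 g

section Comparison

variable {q : ℝ} (hq : 2 ≤ q) {n m : ℕ} (hn : n = 2 * m)
include hq hn

variable {Ω : Type*} [MeasurableSpace Ω] {μ : Measure Ω}
  {X : ℕ → Ω → Fin (n + 1)} (hX : IsMarkovChain (rankTransition q n) X μ)
include hX

lemma pathEvent_stayPath_ge {b : ℤ} (hb : |b| < m) (hx : stepSize q m * totalRate q b ≤ 1)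
    {p : List (Fin (n + 1))} (hp : ∃ t, p = toState n (m + b) :: t) (g : ℕ) :
    μ.real (pathEvent X p) * (1 - stepSize q m * totalRate q b) ^ g
      ≤ μ.real (pathEvent X (stayPath n m b g p)) := by
  induction g with
  | zero => simp [stayPath]
  | succ g ih =>
    obtain ⟨t, ht⟩ := exists_stayPath_eq_cons hp g
    rw [stayPath, ht, hX.pathEvent_cons_cons, hX.pathEvent_cons_cons, ← ht, pow_succ, ← mul_assoc,
      mul_assoc _ (rankTransition _ _ _ _)]
    exact mul_le_mul ih (two_step_stay_ge hq hn hb) (by linarith) measureReal_nonneg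

/-- For tame skeletons, the probability that the rank chain follows a skeleton is almost as large as
that of the corresponding event for the birth and death process. -/
theorem skeletonEvent_le_pathEvent [IsProbabilityMeasure μ] {a L : ℤ} (hL : L < m) {w s : ℝ} (hw0 : 0 ≤ w) (hw : w ≤ 1 / 4)
    (hw1 : ∀ b : ℤ, |b| ≤ L → q ^ (-((m : ℤ) + b)) ≤ w) (hs : 0 ≤ s)
    (hη : (2 * s + 4) * w ≤ 1) (hX0 : ∀ ω, X 0 ω = toState n (m + a)) (l : List (ℕ × Bool))
    (hl : IsTame q (stepSize q m) a L s l) :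
    (1 - (2 * s + 4) * w) ^ l.length
        * (iidLaw innovationLaw).real (skeletonEvent q (stepSize q m) a l)
      ≤ μ.real (pathEvent X (skeletonPath n m a l)) := by
  have hδ := stepSize_pos hq m
  induction l with
  | nil =>
    have : pathEvent X (skeletonPath n m a []) = univ := by
      ext ω
      simp [skeletonPath, pathEvent, hX0]
    rw [this, probReal_univ]
    simp [skeletonEvent]
  | cons p l ih =>
    obtain ⟨g, u⟩ := p
    obtain ⟨ht, hbL, hgs⟩ := hl
    have ih := ih ht
    obtain ⟨t, htl⟩ := exists_stayPath_eq_cons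
      (exists_skeletonPath_eq_cons (n := n) (m := m) a l) g
    have hstay := pathEvent_stayPath_ge hq hn hX (lt_of_le_of_lt hbL hL) (b := endState a l)
      (p := skeletonPath n m a l) (g := g) (hp := exists_skeletonPath_eq_cons a l)
    have hcell := innovationLaw_real_cell_le hq hδ (endState a l) g u
    rw [skeletonPath, htl, hX.pathEvent_cons_cons, hX.pathEvent_cons_cons, ← htl,
      skeletonEvent_real_cons, List.length_cons, pow_succ, endState]
    set b := endState a l
    have hbm : |b| < m := lt_of_le_of_lt hbL hL
    have hwp := hw1 b hbL
    have hwm := hw1 (-b) (by rwa [abs_neg])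
    rw [← sub_eq_add_neg] at hwm
    -- One step of the discretized process has jump probability at most `2 * w`.
    have hx2 : stepSize q m * totalRate q b ≤ 2 * w := by
      have e1 := zpow_div_sub_one hq m b
      have e2 := zpow_div_sub_one hq m (-b)
      rw [neg_neg, ← sub_eq_add_neg] at e2
      have hd : ∀ z : ℝ, 0 ≤ z → z / (q - 1) ≤ z := fun z hz =>
        div_le_self hz (by linarith)
      have d1 := hd (q ^ (-((m : ℤ) + b))) (zpow_nonneg (by linarith) _)
      have d2 := hd (q ^ (-((m : ℤ) - b))) (zpow_nonneg (by linarith) _)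
      rw [totalRate, mul_add]
      linarith
    have hx0 : 0 ≤ stepSize q m * totalRate q b := (mul_pos hδ (totalRate_pos hq b)).le
    have hstay := hstay (by linarith)
    have hjump : stepSize q m * (if u then q ^ (-b) else q ^ b) * (1 - 4 * w)
        ≤ rankTransition q n (toState n (m + b)) (toState n (if u then m - b - 1 else m - b))
          * rankTransition q n (toState n (if u then m - b - 1 else m - b))
            (toState n (m + (b + if u then 1 else -1))) := by
      cases u
      · exact two_step_down_ge hq hn hbm hw hwp hwm
      · exact two_step_up_ge hq hn hbm hw hwp hwm
    have hgeom := exp_mul_le_one_sub_pow hx0 (by linarith) hgs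
    set x := stepSize q m * totalRate q b
    set v := stepSize q m * (if u then q ^ (-b) else q ^ b)
    have hv : 0 ≤ v := by
      have : 0 < q := by linarith
      simp only [v]
      split_ifs <;> positivity
    have hstep : (1 - (2 * s + 4) * w) * innovationLaw.real (innovationCell q (stepSize q m) b g u)
        ≤ (1 - x) ^ g * (v * (1 - 4 * w)) := by
      have h1 : (1 - (2 * s + 4) * w) ≤ (1 - s * x) * (1 - 4 * w) := by
        have h2 : s * x ≤ s * (2 * w) := mul_le_mul_of_nonneg_left hx2 hs
        have h3 : 0 ≤ s * x * w := by positivity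
        nlinarith
      have hexp := Real.exp_pos (-(g * x))
      calc _ ≤ ((1 - s * x) * (1 - 4 * w)) * (Real.exp (-(g * x)) * v) :=
            mul_le_mul h1 hcell measureReal_nonneg (by linarith)
        _ = ((1 - s * x) * Real.exp (-(g * x))) * (v * (1 - 4 * w)) := by ring
        _ ≤ _ := mul_le_mul_of_nonneg_right hgeom (mul_nonneg hv (by linarith))
    have hQ : 0 ≤ (1 - (2 * s + 4) * w) ^ l.length
        * (iidLaw innovationLaw).real (skeletonEvent q (stepSize q m) a l) :=
      mul_nonneg (pow_nonneg (by linarith) _) measureReal_nonneg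
    have hx1 : 0 ≤ (1 - x) ^ g := pow_nonneg (by linarith) _
    calc _ = ((1 - (2 * s + 4) * w) ^ l.length
            * (iidLaw innovationLaw).real (skeletonEvent q (stepSize q m) a l))
            * ((1 - (2 * s + 4) * w)
              * innovationLaw.real (innovationCell q (stepSize q m) b g u)) := by ring
      _ ≤ μ.real (pathEvent X (skeletonPath n m a l)) * ((1 - x) ^ g * (v * (1 - 4 * w))) :=
          mul_le_mul ih hstep (mul_nonneg (by linarith) measureReal_nonneg) measureReal_nonneg
      _ = (μ.real (pathEvent X (skeletonPath n m a l)) * (1 - x) ^ g) * (v * (1 - 4 * w)) := by ring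
      _ ≤ _ := (mul_le_mul hstay hjump (mul_nonneg hv (by linarith)) measureReal_nonneg).trans_eq
          (mul_assoc _ _ _).symm

end Comparison

/-! ### Jump times of processes with the same skeleton -/

section SameSkeleton

variable {q : ℝ} (hq : 2 ≤ q) {n m : ℕ} (hn : n = 2 * m) {Ω : Type*} {X : ℕ → Ω → Fin (n + 1)}
include hq

/-- The discrete times `2 * G i` of the jumps of a rank chain that has the same skeleton as the birth
and death process. -/
lemma exists_jumpSteps {a L : ℤ} {δ s : ℝ} {l : List (ℕ × Bool)}
    (hl : IsTame q δ a L s l) {ω₁ : Ω} (h₁ : ω₁ ∈ pathEvent X (skeletonPath n m a l))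
    {ω₂ : ℕ → ℝ × ℝ} (hpos : ∀ i, 0 < (ω₂ i).1) (h₂ : ω₂ ∈ skeletonEvent q δ a l) :
    ∃ G : ℕ → ℕ, G 0 = 0 ∧ G l.length = duration l ∧ ∀ i < l.length,
      |zState q a ω₂ i| ≤ L ∧ G i < G (i + 1) ∧
      (∀ j, G i ≤ j → j < G (i + 1) → X (2 * j) ω₁ = toState n (m + zState q a ω₂ i)) ∧
      ((G (i + 1) : ℝ) - G i - 1) * δ ≤ holdingTime q (zState q a ω₂ i) (ω₂ i) ∧
      holdingTime q (zState q a ω₂ i) (ω₂ i) ≤ ((G (i + 1) : ℝ) - G i) * δ := by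
  induction l with
  | nil => exact ⟨fun _ => 0, rfl, rfl, fun i hi => absurd hi (Nat.not_lt_zero i)⟩
  | cons p l ih =>
    obtain ⟨g, u⟩ := p
    obtain ⟨j1, j2, -⟩ := of_mem_pathEvent_skeletonPath h₁
    obtain ⟨G, hG0, hGl, hG⟩ := ih hl.1 j1 h₂.1
    have hb := zState_of_mem_skeletonEvent h₂.1
    refine ⟨fun i => if i ≤ l.length then G i else duration ((g, u) :: l), ?_, ?_, fun i hi => ?_⟩
    · simp [hG0]
    · simp
    · rcases Nat.lt_succ_iff_lt_or_eq.1 hi with hi | rfl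
      · simp only [hi.le, Nat.succ_le_of_lt hi, if_true]
        exact hG i hi
      · have e : ¬l.length + 1 ≤ l.length := by lia
        simp only [le_refl, if_true, e, if_false, hGl, hb]
        have hcell := h₂.2.1
        have hR := totalRate_pos hq (endState a l)
        rw [coe_holdingTime hq (hpos _).le, le_div_iff₀ hR, div_le_iff₀ hR]
        have hd : ((duration ((g, u) :: l) : ℕ) : ℝ) = duration l + (g + 1) := by
          simp [duration]
        refine ⟨hl.2.1, by simp only [duration]; lia, j2, ?_, ?_⟩
        · rw [hd]
          linarith [hcell.1]
        · rw [hd]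
          linarith [hcell.2]

include hn

/-- Two processes with the same skeleton have the same embedded chain, and their `i`-th jump times
differ by at most `i` steps of the discrete process. -/
theorem jumpTime_rescaled_close {a L : ℤ} (haL : |a| ≤ L) (hL : L < m) {s : ℝ}
    {l : List (ℕ × Bool)} (hl : IsTame q (stepSize q m) a L s l) {ω₁ : Ω}
    (h₁ : ω₁ ∈ pathEvent X (skeletonPath n m a l)) {ω₂ : ℕ → ℝ × ℝ}
    (hreg : ω₂ ∈ regularEvent q a) (h₂ : ω₂ ∈ skeletonEvent q (stepSize q m) a l) :
    ∀ i ≤ l.length,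
      jumpTime (fun t => rescaled q n (fun k => X k ω₁) t) i ≠ ∞ ∧
      jumpTime (fun t => zPath q a t ω₂) i ≠ ∞ ∧
      embeddedChain (fun t => rescaled q n (fun k => X k ω₁) t) i
        = embeddedChain (fun t => zPath q a t ω₂) i ∧
      |(jumpTime (fun t => rescaled q n (fun k => X k ω₁) t) i).toReal
        - (jumpTime (fun t => zPath q a t ω₂) i).toReal| ≤ i * stepSize q m := by
  have hq0 : 0 < q := by linarith
  have hδ := stepSize_pos hq m
  obtain ⟨G, hG0, hGl, hG⟩ := exists_jumpSteps hq hl h₁ hreg.1 h₂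
  have hb := zState_of_mem_skeletonEvent h₂
  have hend : X (2 * duration l) ω₁ = toState n (m + endState a l) := by
    match l with
    | [] => exact h₁.2
    | (g, u) :: l => exact (of_mem_pathEvent_skeletonPath h₁).2.2
  have hendL : |endState a l| ≤ m := by
    match l with
    | [] => exact haL.trans hL.le
    | (g, u) :: l =>
      have := abs_le.1 hl.2.1
      rw [endState, abs_le]
      split_ifs <;> lia
  -- The rescaled process at time `t` is the chain at twice the integer part of `t / δ`.
  have hscale : q ^ ((n : ℝ) / 2) * (q - 1) = (stepSize q m)⁻¹ := by
    rw [stepSize, hn, Nat.cast_mul, Nat.cast_two, mul_div_cancel_left₀ _ two_ne_zero,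
      Real.rpow_natCast, zpow_neg, zpow_natCast, inv_div, div_inv_eq_mul, mul_comm]
  have hresc : ∀ (u : ℝ≥0) (j : ℕ) (b : ℤ), |b| ≤ m →
      ⌊(stepSize q m)⁻¹ * (u : ℝ)⌋₊ = j → X (2 * j) ω₁ = toState n (m + b) →
      rescaled q n (fun k => X k ω₁) u = b := by
    intro u j b hbm hj hX
    rw [abs_le] at hbm
    rw [rescaled, hscale, hj, hX, coe_toState (by lia) (by lia)]
    lia
  let T : ℕ → ℝ≥0 := fun i => (G i * stepSize q m).toNNReal
  have hT : ∀ i, (T i : ℝ) = G i * stepSize q m := fun i =>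
    Real.coe_toNNReal _ (by positivity)
  have hfl : ∀ i, ⌊(stepSize q m)⁻¹ * (T i : ℝ)⌋₊ = G i := fun i => by
    rw [hT, mul_comm, mul_assoc, mul_inv_cancel₀ hδ.ne', mul_one, Nat.floor_natCast]
  have hjump := jumpTime_eq_and_embeddedChain_eq
    (z := fun t => rescaled q n (fun k => X k ω₁) t) (T := T) (x := zState q a ω₂)
    (N := l.length)
    (NNReal.coe_injective (by rw [hT, hG0]; simp))
    (fun i hi => by
      rw [← NNReal.coe_lt_coe, hT, hT]
      exact mul_lt_mul_of_pos_right (by exact_mod_cast (hG i hi).2.1) hδ)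
    (fun i hi u h1 h2 => by
      rw [← NNReal.coe_le_coe, hT, ← le_div_iff₀ hδ, div_eq_inv_mul] at h1
      rw [← NNReal.coe_lt_coe, hT, ← div_lt_iff₀ hδ, div_eq_inv_mul] at h2
      have hu : 0 ≤ (stepSize q m)⁻¹ * (u : ℝ) := by positivity
      exact hresc u _ _ ((hG i hi).1.trans hL.le) rfl
        ((hG i hi).2.2.1 _ (Nat.le_floor h1) ((Nat.floor_lt hu).2 h2)))
    (hresc _ _ _ (by rw [hb]; exact hendL) (hfl _) (by rw [hGl, hb]; exact hend))
    (fun i _ => zStep_ne q _ _)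
  have hclose : ∀ i ≤ l.length, |(T i : ℝ) - zTime q a ω₂ i| ≤ i * stepSize q m := by
    intro i
    induction i with
    | zero => intro _; simp [hT, hG0, zTime]
    | succ i ih =>
      intro hi
      obtain ⟨-, -, -, h3, h4⟩ := hG i hi
      have h5 := abs_le.1 (ih (by lia))
      rw [hT] at h5
      rw [hT, zTime_succ, NNReal.coe_add, abs_le]
      push_cast
      constructor <;> nlinarith
  intro i hi
  obtain ⟨e1, e2⟩ := hjump i hi
  obtain ⟨e3, e4⟩ := jumpTime_zPath a hq hreg i
  rw [e1, e2, e3, e4]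
  exact ⟨ENNReal.coe_ne_top, ENNReal.coe_ne_top, rfl, hclose i hi⟩

end SameSkeleton

/-! ### The coupling -/

section Coupling

variable {q : ℝ} (hq : 2 ≤ q)
include hq

/-- Up to a small probability, the first `N` innovations have holding times of at most `s` means and
do not allow a jump out of `[-L, L]`: a jump upwards from `L` needs a uniform variable below
`upProb q L`, and a jump downwards from `-L` one above `upProb q (-L)`. -/
lemma measureReal_innovations_ge (L : ℤ) {s : ℝ} (hs : 0 ≤ s) (N : ℕ) :
    1 - N * (Real.exp (-s) + 2 * upProb q L) ≤ (iidLaw innovationLaw).real {ω | ∀ i < N,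
      0 < (ω i).1 ∧ (ω i).1 ≤ s ∧ upProb q L ≤ (ω i).2 ∧ (ω i).2 < upProb q (-L)} := by
  have hu0 := upProb_nonneg hq L
  have hu1 := upProb_le_one hq L
  have hv0 := upProb_nonneg hq (-L)
  have hv1 := upProb_le_one hq (-L)
  have hm1 : MeasurableSet {w : ℝ × ℝ | w.1 ≤ 0} := measurableSet_le measurable_fst measurable_const
  have hm2 : MeasurableSet {w : ℝ × ℝ | s < w.1} := measurableSet_lt measurable_const measurable_fst
  have hm3 : MeasurableSet {w : ℝ × ℝ | w.2 < upProb q L} :=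
    measurableSet_lt measurable_snd measurable_const
  have hm4 : MeasurableSet {w : ℝ × ℝ | upProb q (-L) ≤ w.2} :=
    measurableSet_le measurable_const measurable_snd
  let B : Set (ℝ × ℝ) := {w | w.1 ≤ 0} ∪ {w | s < w.1} ∪ {w | w.2 < upProb q L}
    ∪ {w | upProb q (-L) ≤ w.2}
  have hBm : MeasurableSet B := ((hm1.union hm2).union hm3).union hm4
  have hB : innovationLaw.real B ≤ Real.exp (-s) + 2 * upProb q L := by
    have h1 := innovationLaw_real_fst_le le_rfl
    rw [neg_zero, Real.exp_zero, sub_self] at h1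
    have h4 := one_sub_upProb_eq hq (-L)
    rw [neg_neg] at h4
    have i1 := measureReal_union_le (μ := innovationLaw) {w | w.1 ≤ 0} {w | s < w.1}
    have i2 := measureReal_union_le (μ := innovationLaw) ({w | w.1 ≤ 0} ∪ {w | s < w.1})
      {w | w.2 < upProb q L}
    have i3 := measureReal_union_le (μ := innovationLaw)
      ({w | w.1 ≤ 0} ∪ {w | s < w.1} ∪ {w | w.2 < upProb q L}) {w | upProb q (-L) ≤ w.2}
    rw [innovationLaw_real_snd_ge hv0 hv1, h4] at i3
    rw [innovationLaw_real_snd_lt hu0 hu1] at i2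
    rw [innovationLaw_real_fst hs, h1] at i1
    linarith
  have hev : MeasurableSet (⋃ i ∈ Finset.range N, {ω : ℕ → ℝ × ℝ | ω i ∈ B}) :=
    Finset.measurableSet_biUnion _ fun i _ => measurable_pi_apply i hBm
  have hset : {ω : ℕ → ℝ × ℝ | ∀ i < N,
      0 < (ω i).1 ∧ (ω i).1 ≤ s ∧ upProb q L ≤ (ω i).2 ∧ (ω i).2 < upProb q (-L)}
      = (⋃ i ∈ Finset.range N, {ω : ℕ → ℝ × ℝ | ω i ∈ B})ᶜ := by
    ext ω
    simp only [B, mem_ofPred_eq, mem_compl_iff, mem_iUnion, Finset.mem_range, mem_union,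
      exists_prop, not_exists, not_and, not_or, not_le, not_lt, and_assoc]
  rw [hset, probReal_compl_eq_one_sub hev]
  have hle : (iidLaw innovationLaw).real (⋃ i ∈ Finset.range N, {ω : ℕ → ℝ × ℝ | ω i ∈ B})
      ≤ N * (Real.exp (-s) + 2 * upProb q L) := by
    refine (measureReal_biUnion_finset_le _ _).trans ?_
    refine (Finset.sum_le_card_nsmul _ _ (Real.exp (-s) + 2 * upProb q L) fun i _ => ?_).trans
      (by rw [Finset.card_range, nsmul_eq_mul])
    rw [measureReal_def, iidLaw_innovation innovationLaw hBm]
    exact hB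
  linarith

variable {n m : ℕ} (hn : n = 2 * m)
include hn

/-- A coupling of the two processes, with explicit error terms: the comparison of the skeletons,
the exceptional innovations, and the lower tail of the jump time of the birth and death process. -/
theorem exists_process_coupling {Ω : Type*} [MeasurableSpace Ω] {μ : Measure Ω}
    [IsProbabilityMeasure μ] {X : ℕ → Ω → Fin (n + 1)}
    (hX : IsMarkovChain (rankTransition q n) X μ) {a L : ℤ}
    (hX0 : ∀ ω, X 0 ω = toState n (m + a)) (haL : |a| ≤ L) (hL : L < m) {w s : ℝ} (hw0 : 0 ≤ w)
    (hw : w ≤ 1 / 4) (hw1 : ∀ b : ℤ, |b| ≤ L → q ^ (-((m : ℤ) + b)) ≤ w) (hs : 0 ≤ s)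
    (hη : (2 * s + 4) * w ≤ 1) (N : ℕ) (t : ℝ≥0) :
    ∃ π : Measure (Ω × (ℕ → ℝ × ℝ)), MeasurePreserving Prod.fst π μ ∧
      MeasurePreserving Prod.snd π (iidLaw innovationLaw) ∧
      ∃ E : Set (Ω × (ℕ → ℝ × ℝ)), MeasurableSet E ∧
        1 - N * ((2 * s + 4) * w) - N * (Real.exp (-s) + 2 * upProb q L)
          - Real.exp t * ((97 / 100) ^ N * (11 / 10 : ℝ) ^ a.natAbs) ≤ π.real E ∧
        ∀ ω ∈ E, (∀ i ≤ N,
          jumpTime (fun t => rescaled q n (fun k => X k ω.1) t) i ≠ ∞ ∧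
          jumpTime (fun t => zPath q a t ω.2) i ≠ ∞ ∧
          embeddedChain (fun t => rescaled q n (fun k => X k ω.1) t) i
            = embeddedChain (fun t => zPath q a t ω.2) i ∧
          |(jumpTime (fun t => rescaled q n (fun k => X k ω.1) t) i).toReal
            - (jumpTime (fun t => zPath q a t ω.2) i).toReal| ≤ i * stepSize q m) ∧
          (t : ℝ≥0∞) ≤ jumpTime (fun t => zPath q a t ω.2) N := by
  have hδ := stepSize_pos hq m
  let ι := {l : List (ℕ × Bool) // l.length = N ∧ IsTame q (stepSize q m) a L s l}
  let A : ι → Set Ω := fun l => pathEvent X (skeletonPath n m a l.1)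
  let B : ι → Set (ℕ → ℝ × ℝ) := fun l => skeletonEvent q (stepSize q m) a l.1
  have hA : ∀ l, MeasurableSet (A l) := fun l => measurableSet_pathEvent hX.measurable _
  have hB : ∀ l, MeasurableSet (B l) := fun l => measurableSet_skeletonEvent q _ a _
  have dA : Pairwise (Function.onFun Disjoint A) := fun l l' hne =>
    Set.disjoint_left.2 fun ω h h' => hne (Subtype.ext
      (skeletonPath_injective hn hL (l.2.1.trans l'.2.1.symm) l.2.2 l'.2.2 h h'))
  have dB : Pairwise (Function.onFun Disjoint B) := fun l l' hne =>
    Set.disjoint_left.2 fun ω h h' => hne (Subtype.ext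
      (skeletonEvent_injective hq hδ (l.2.1.trans l'.2.1.symm) h h'))
  set η := (2 * s + 4) * w
  have hη0 : 0 ≤ η := by positivity
  have hc0 : 0 ≤ (1 - η) ^ N := pow_nonneg (by linarith) _
  obtain ⟨π, hπ₁, hπ₂, hπ⟩ := exists_coupling (P := μ) (Q := iidLaw innovationLaw) hA hB dA dB
    (c := ENNReal.ofReal ((1 - η) ^ N))
    (ENNReal.ofReal_le_one.2 (pow_le_one₀ (by linarith) (by linarith))) (fun l => by
      have h := skeletonEvent_le_pathEvent hq hn hX hL hw0 hw hw1 hs hη hX0 l.1 l.2.2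
      rw [l.2.1] at h
      rw [← ofReal_measureReal, ← ofReal_measureReal, ← ENNReal.ofReal_mul hc0]
      exact ENNReal.ofReal_le_ofReal h)
  have p₁ : MeasurePreserving Prod.fst π μ := ⟨measurable_fst, hπ₁⟩
  have p₂ : MeasurePreserving Prod.snd π (iidLaw innovationLaw) := ⟨measurable_snd, hπ₂⟩
  have : IsProbabilityMeasure π := by
    constructor
    rw [← p₁.measure_preimage MeasurableSet.univ.nullMeasurableSet |>.trans measure_univ,
      preimage_univ]
  let D : Set (ℕ → ℝ × ℝ) := regularEvent q a ∩ {ω | t < zTime q a ω N}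
  have hDm : MeasurableSet D := (measurableSet_regularEvent q a).inter
    (measurableSet_lt measurable_const (measurable_zTime q a N))
  have hUm : MeasurableSet (⋃ l, A l ×ˢ B l) := .iUnion fun l => (hA l).prod (hB l)
  refine ⟨π, p₁, p₂, (⋃ l, A l ×ˢ B l) ∩ Prod.snd ⁻¹' D, hUm.inter (measurable_snd hDm), ?_, ?_⟩
  · have h1 : (1 - η) ^ N * (iidLaw innovationLaw).real (⋃ l, B l)
        ≤ π.real (⋃ l, A l ×ˢ B l) := by
      rw [← ENNReal.ofReal_le_ofReal_iff measureReal_nonneg, ENNReal.ofReal_mul hc0,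
        ofReal_measureReal, ofReal_measureReal]
      exact hπ
    have h2 : 1 - N * (Real.exp (-s) + 2 * upProb q L)
        ≤ (iidLaw innovationLaw).real (⋃ l, B l) := by
      refine (measureReal_innovations_ge hq L hs N).trans (measureReal_mono fun ω hω => ?_)
      obtain ⟨l, hl, ht, -, h⟩ := exists_isTame hq hδ haL hω
      exact mem_iUnion.2 ⟨⟨l, hl, ht⟩, h⟩
    have h3 : (1 : ℝ) - N * η ≤ (1 - η) ^ N := by
      have := one_add_mul_le_pow (a := -η) (by linarith) N
      rw [← sub_eq_add_neg] at this
      linarith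
    have h4 : (iidLaw innovationLaw).real Dᶜ
        ≤ Real.exp t * ((97 / 100) ^ N * (11 / 10 : ℝ) ^ a.natAbs) := by
      have hsub : (iidLaw innovationLaw) Dᶜ
          ≤ iidLaw innovationLaw {ω | zTime q a ω N ≤ t} := by
        refine measure_mono_ae ?_
        filter_upwards [ae_regularEvent hq a] with ω hω h
        exact not_lt.1 fun hlt => h ⟨hω, hlt⟩
      exact ENNReal.toReal_le_of_le_ofReal (by positivity)
        (hsub.trans (measure_zTime_le hq a N t))
    have h5 : π.real (⋃ l, A l ×ˢ B l)
        ≤ π.real ((⋃ l, A l ×ˢ B l) ∩ Prod.snd ⁻¹' D) + (iidLaw innovationLaw).real Dᶜ := by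
      rw [← p₂.measureReal_preimage hDm.compl.nullMeasurableSet]
      refine (measureReal_mono fun ω hω => ?_).trans (measureReal_union_le _ _)
      by_cases hD : ω.2 ∈ D
      · exact Or.inl ⟨hω, hD⟩
      · exact Or.inr hD
    have h6 : (iidLaw innovationLaw).real (⋃ l, B l) ≤ 1 := measureReal_le_one
    have h7 : 0 ≤ (iidLaw innovationLaw).real (⋃ l, B l) := measureReal_nonneg
    have h8 : (1 : ℝ) - N * η - N * (Real.exp (-s) + 2 * upProb q L)
        ≤ (1 - η) ^ N * (iidLaw innovationLaw).real (⋃ l, B l) := by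
      have h9 : 0 ≤ N * η := by positivity
      nlinarith
    linarith
  · rintro ⟨ω₁, ω₂⟩ ⟨hω, hreg, htime⟩
    obtain ⟨l, h₁, h₂⟩ := mem_iUnion.1 hω
    refine ⟨fun i hi => jumpTime_rescaled_close hq hn haL hL l.2.2 h₁ hreg h₂ i
      (by rw [l.2.1]; exact hi), ?_⟩
    rw [(jumpTime_zPath a hq hreg N).1]
    exact ENNReal.coe_le_coe.2 (le_of_lt htime)

end Coupling

/-! ### Error estimates in terms of `y = q ^ (n / 50)` -/

lemma exp_mul_pow_le {y z : ℝ} (hy : 1 ≤ y) (hz0 : 0 ≤ z) (hz : z ≤ y ^ 8) {N : ℕ} (hN : y ^ 8 ≤ N + 1) :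
    Real.exp (y ^ 4) * ((97 / 100) ^ N * z) ≤ 24 * Real.exp 34 * (y ^ 8)⁻¹ := by
  have hy0 : 0 < y := by linarith
  have h1 : (97 / 100 : ℝ) ^ N ≤ Real.exp (-(3 / 100) * N) := by
    rw [mul_comm, Real.exp_nat_mul]
    refine pow_le_pow_left₀ (by norm_num) ?_ N
    linarith [Real.add_one_le_exp (-(3 / 100) : ℝ)]
  have h2 : (y ^ 4) ^ 4 ≤ 24 * Real.exp (y ^ 4) := by
    have := Real.pow_div_factorial_le_exp (y ^ 4) (by positivity) 4
    rw [show ((4 : ℕ).factorial : ℝ) = 24 by norm_num [Nat.factorial], div_le_iff₀ (by norm_num)]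
      at this
    linarith
  -- Completing the square in `y ^ 4`.
  have h3 : y ^ 4 + y ^ 4 + -(3 / 100) * (N : ℝ) ≤ 34 := by
    nlinarith [sq_nonneg (y ^ 4 - 100 / 3)]
  have h4 : Real.exp (y ^ 4) * (Real.exp (y ^ 4) * Real.exp (-(3 / 100) * N)) ≤ Real.exp 34 := by
    rw [← Real.exp_add, ← Real.exp_add, ← add_assoc]
    exact Real.exp_le_exp.2 h3
  rw [← div_eq_mul_inv, le_div_iff₀ (by positivity)]
  have he := Real.exp_pos (y ^ 4)
  calc Real.exp (y ^ 4) * ((97 / 100) ^ N * z) * y ^ 8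
      ≤ Real.exp (y ^ 4) * (Real.exp (-(3 / 100) * N) * y ^ 8) * y ^ 8 := by gcongr
    _ = Real.exp (y ^ 4) * Real.exp (-(3 / 100) * N) * (y ^ 4) ^ 4 := by ring
    _ ≤ Real.exp (y ^ 4) * Real.exp (-(3 / 100) * N) * (24 * Real.exp (y ^ 4)) := by gcongr
    _ = 24 * (Real.exp (y ^ 4) * (Real.exp (y ^ 4) * Real.exp (-(3 / 100) * N))) := by ring
    _ ≤ 24 * Real.exp 34 := by gcongr

lemma log_error_le {y : ℝ} (hy : 1 ≤ y) :
    (2 * (16 * Real.log y) + 4) * (y ^ 17)⁻¹ ≤ 36 * (y ^ 16)⁻¹ := by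
  have hy0 : 0 < y := by linarith
  have h1 := Real.log_le_sub_one_of_pos hy0
  have h2 : (2 * (16 * Real.log y) + 4) ≤ 36 * y := by linarith
  calc (2 * (16 * Real.log y) + 4) * (y ^ 17)⁻¹ ≤ 36 * y * (y ^ 17)⁻¹ := by gcongr
    _ = 36 * (y ^ 16)⁻¹ := by field_simp

end RankCoupling

theorem mainTheorem4 (q : ℕ) (hq : IsPrimePow q) (α : ℝ) (hα : α = 0.08) :
    ∃ C : ℝ, ∀ n : ℕ, Even n → ∀ a : ℤ, |(a : ℝ)| ≤ 2 * α * n →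
      ∃ (Ω : Type) (_ : MeasurableSpace Ω) (μ : Measure Ω) (_ : IsProbabilityMeasure μ)
        (X : ℕ → Ω → Fin (n + 1)) (Y Z : ℝ≥0 → Ω → ℤ),
        RankCoupling.IsMarkovChain (RankCoupling.rankTransition q n) X μ ∧
        (∀ t ω, Y t ω = RankCoupling.rescaled q n (fun i => X i ω) t) ∧
        RankCoupling.IsContinuousTimeMarkovChain (RankCoupling.birthDeathRate q) Z μ ∧
        (∀ᵐ ω ∂μ, Y 0 ω = a ∧ Z 0 ω = a) ∧
        ∃ E : Set Ω, MeasurableSet E ∧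
          1 - C * (q : ℝ) ^ (-(2 * α * n)) ≤ μ.real E ∧
          ∀ ω ∈ E,
            (∀ i : ℕ, (i : ℝ) ≤ (q : ℝ) ^ (2 * α * n) →
              RankCoupling.jumpTime (fun t => Y t ω) i ≠ ∞ ∧
              RankCoupling.jumpTime (fun t => Z t ω) i ≠ ∞ ∧
              RankCoupling.embeddedChain (fun t => Y t ω) i
                = RankCoupling.embeddedChain (fun t => Z t ω) i ∧
              |(RankCoupling.jumpTime (fun t => Y t ω) i).toReal
                - (RankCoupling.jumpTime (fun t => Z t ω) i).toReal|
                  ≤ (q : ℝ) ^ (-(α * n))) ∧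
            ENNReal.ofReal ((q : ℝ) ^ (α * n))
              ≤ RankCoupling.jumpTime (fun t => Z t ω) ⌊(q : ℝ) ^ (2 * α * n)⌋₊ := by
  have hq2 : (2 : ℝ) ≤ q := by exact_mod_cast hq.two_le
  have hq1 : (1 : ℝ) < q := by linarith
  have hq0 : (0 : ℝ) < q := by linarith
  refine ⟨37 + 2 * (q : ℝ) ^ 2 + 24 * Real.exp 34, fun n hn a ha => ?_⟩
  obtain ⟨m, hm⟩ := hn
  have hnm : n = 2 * m := by lia
  have hnm' : (n : ℝ) = 2 * m := by exact_mod_cast hnm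
  rw [hα] at ha ⊢
  have ham : |a| ≤ m := by
    have : |(a : ℝ)| ≤ m := by
      have hm0 : (0 : ℝ) ≤ m := by positivity
      rw [hnm'] at ha
      linarith
    exact_mod_cast this
  obtain ⟨Ω, _, μ, _, X, hX, hX0⟩ := RankCoupling.exists_isMarkovChain
    (RankCoupling.rankTransition_nonneg hq1) (RankCoupling.sum_rankTransition hq1)
    (RankCoupling.toState n (m + a))
  -- All error terms are powers of `y`.
  set y : ℝ := (q : ℝ) ^ (0.02 * (n : ℝ)) with hy
  have hpow : ∀ (k : ℕ) (c : ℝ), c = 0.02 * k → (q : ℝ) ^ (c * n) = y ^ k := by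
    intro k c hc
    rw [hy, ← Real.rpow_natCast, ← Real.rpow_mul hq0.le, hc]
    congr 1
    ring
  have e8 : (q : ℝ) ^ (2 * 0.08 * (n : ℝ)) = y ^ 8 := hpow 8 _ (by norm_num)
  have e8' : (q : ℝ) ^ (-(2 * 0.08 * (n : ℝ))) = (y ^ 8)⁻¹ := by rw [Real.rpow_neg hq0.le, e8]
  have e4 : (q : ℝ) ^ (0.08 * (n : ℝ)) = y ^ 4 := hpow 4 _ (by norm_num)
  have e4' : (q : ℝ) ^ (-(0.08 * (n : ℝ))) = (y ^ 4)⁻¹ := by rw [Real.rpow_neg hq0.le, e4]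
  have hy1 : 1 ≤ y := Real.one_le_rpow hq1.le (by positivity)
  have hy0 : 0 < y := by linarith
  rw [e8, e8', e4, e4']
  set C : ℝ := 37 + 2 * (q : ℝ) ^ 2 + 24 * Real.exp 34 with hC
  suffices h : ∃ π : Measure (Ω × (ℕ → ℝ × ℝ)), MeasurePreserving Prod.fst π μ ∧
      MeasurePreserving Prod.snd π (RankCoupling.iidLaw RankCoupling.innovationLaw) ∧
      ∃ E : Set (Ω × (ℕ → ℝ × ℝ)), MeasurableSet E ∧ 1 - C * (y ^ 8)⁻¹ ≤ π.real E ∧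
        ∀ ω ∈ E, (∀ i : ℕ, (i : ℝ) ≤ y ^ 8 →
          RankCoupling.jumpTime (fun t => RankCoupling.rescaled q n (fun k => X k ω.1) t) i ≠ ∞ ∧
          RankCoupling.jumpTime (fun t => RankCoupling.zPath q a t ω.2) i ≠ ∞ ∧
          RankCoupling.embeddedChain (fun t => RankCoupling.rescaled q n (fun k => X k ω.1) t) i
            = RankCoupling.embeddedChain (fun t => RankCoupling.zPath q a t ω.2) i ∧
          |(RankCoupling.jumpTime
              (fun t => RankCoupling.rescaled q n (fun k => X k ω.1) t) i).toReal
            - (RankCoupling.jumpTime (fun t => RankCoupling.zPath q a t ω.2) i).toReal|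
              ≤ (y ^ 4)⁻¹) ∧
          ENNReal.ofReal (y ^ 4)
            ≤ RankCoupling.jumpTime (fun t => RankCoupling.zPath q a t ω.2) ⌊y ^ 8⌋₊ by
    obtain ⟨π, p₁, p₂, E, hE, hbound, hgood⟩ := h
    have hπ : IsProbabilityMeasure π := ⟨by
      rw [← p₁.measure_preimage MeasurableSet.univ.nullMeasurableSet |>.trans measure_univ,
        preimage_univ]⟩
    refine ⟨Ω × (ℕ → ℝ × ℝ), inferInstance, π, hπ, fun k ω => X k ω.1,
      fun t ω => RankCoupling.rescaled q n (fun k => X k ω.1) t,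
      fun t ω => RankCoupling.zPath q a t ω.2, hX.comp_measurePreserving p₁, fun _ _ => rfl,
      RankCoupling.isContinuousTimeMarkovChain_zPath hq2 a p₂,
      .of_forall fun ω => ⟨?_, RankCoupling.zPath_zero a hq2 _⟩, E, hE, hbound, hgood⟩
    rw [abs_le] at ham
    change RankCoupling.rescaled q n (fun k => X k ω.1) 0 = a
    rw [RankCoupling.rescaled, NNReal.coe_zero, mul_zero, Nat.floor_zero, mul_zero, hX0,
      RankCoupling.coe_toState (by lia) (by lia)]
    lia
  by_cases htriv : 1 ≤ C * (y ^ 8)⁻¹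
  · -- The claim is trivial if the exceptional probability may be one.
    refine ⟨μ.prod (RankCoupling.iidLaw RankCoupling.innovationLaw), measurePreserving_fst,
      measurePreserving_snd, ∅, .empty, ?_, fun ω hω => absurd hω (notMem_empty ω)⟩
    rw [measureReal_empty]
    linarith
  rw [not_le, ← div_eq_mul_inv, div_lt_one (by positivity)] at htriv
  have hC37 : 37 ≤ C := by
    have : 0 ≤ 2 * (q : ℝ) ^ 2 + 24 * Real.exp 34 := by positivity
    linarith
  have hn0 : 0 < n := by
    rcases Nat.eq_zero_or_pos n with h | h
    · rw [hy, h] at htriv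
      norm_num at htriv
      linarith
    · exact h
  have hn0' : (0 : ℝ) < n := by exact_mod_cast hn0
  set L : ℤ := ⌊2 * 0.08 * (n : ℝ)⌋ with hLdef
  have hL1 : (L : ℝ) ≤ 2 * 0.08 * n := Int.floor_le _
  have hL2 : 2 * 0.08 * (n : ℝ) < L + 1 := Int.lt_floor_add_one _
  have haL : |a| ≤ L := Int.le_floor.2 (by exact_mod_cast ha)
  have hLm : L < m := by
    have : (L : ℝ) < (m : ℝ) := by linarith
    exact_mod_cast this
  have hs : 0 ≤ 16 * Real.log y := by
    have := Real.log_nonneg hy1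
    positivity
  have hy16 : y ^ 8 ≤ y ^ 16 := pow_le_pow_right₀ hy1 (by norm_num)
  have hy17 : y ^ 8 ≤ y ^ 17 := pow_le_pow_right₀ hy1 (by norm_num)
  have hw4 : (y ^ 17)⁻¹ ≤ 1 / 4 := by
    rw [inv_eq_one_div]
    exact one_div_le_one_div_of_le (by norm_num) (by linarith)
  have hw : ∀ b : ℤ, |b| ≤ L → (q : ℝ) ^ (-((m : ℤ) + b)) ≤ (y ^ 17)⁻¹ := by
    intro b hb
    have hb' : (-L : ℝ) ≤ b := by exact_mod_cast (abs_le.1 hb).1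
    rw [← hpow 17 0.34 (by norm_num), ← Real.rpow_neg hq0.le, ← Real.rpow_intCast]
    refine Real.rpow_le_rpow_of_exponent_le hq1.le ?_
    push_cast
    linarith
  have hlog := RankCoupling.log_error_le hy1
  have hη : (2 * (16 * Real.log y) + 4) * (y ^ 17)⁻¹ ≤ 1 := by
    refine hlog.trans ?_
    rw [← div_eq_mul_inv]
    exact div_le_one_of_le₀ (by linarith) (by positivity)
  obtain ⟨π, p₁, p₂, E, hE, hbound, hgood⟩ := RankCoupling.exists_process_coupling hq2 hnm hX hX0
    haL hLm (by positivity) hw4 hw hs hη ⌊y ^ 8⌋₊ (y ^ 4).toNNReal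
  have hN : (⌊y ^ 8⌋₊ : ℝ) ≤ y ^ 8 := Nat.floor_le (by positivity)
  have hN' : y ^ 8 ≤ (⌊y ^ 8⌋₊ : ℝ) + 1 := (Nat.lt_floor_add_one _).le
  refine ⟨π, p₁, p₂, E, hE, le_trans ?_ hbound, fun ω hω => ?_⟩
  · have hexp : Real.exp (-(16 * Real.log y)) = (y ^ 16)⁻¹ := by
      rw [Real.exp_neg, mul_comm, Real.exp_mul, Real.exp_log hy0]
      norm_cast
    have hup : RankCoupling.upProb q L ≤ (q : ℝ) ^ 2 * (y ^ 16)⁻¹ := by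
      refine (RankCoupling.upProb_le hq2 L).trans ?_
      rw [← hpow 16 0.32 (by norm_num), ← Real.rpow_neg hq0.le, ← Real.rpow_intCast,
        ← Real.rpow_natCast, ← Real.rpow_add hq0]
      refine Real.rpow_le_rpow_of_exponent_le hq1.le ?_
      push_cast
      linarith
    have hstart : (11 / 10 : ℝ) ^ a.natAbs ≤ y ^ 8 := by
      have h1 : (a.natAbs : ℝ) ≤ 2 * 0.08 * n := by rwa [Nat.cast_natAbs, Int.cast_abs]
      calc (11 / 10 : ℝ) ^ a.natAbs ≤ (q : ℝ) ^ a.natAbs :=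
            pow_le_pow_left₀ (by norm_num) (by linarith) _
        _ = (q : ℝ) ^ (a.natAbs : ℝ) := (Real.rpow_natCast _ _).symm
        _ ≤ (q : ℝ) ^ (2 * 0.08 * (n : ℝ)) := Real.rpow_le_rpow_of_exponent_le hq1.le h1
        _ = y ^ 8 := e8
    have htail := RankCoupling.exp_mul_pow_le hy1 (by positivity) hstart hN'
    have hinv : y ^ 8 * (y ^ 16)⁻¹ = (y ^ 8)⁻¹ := by field_simp
    have h1 : (⌊y ^ 8⌋₊ : ℝ) * ((2 * (16 * Real.log y) + 4) * (y ^ 17)⁻¹) ≤ 36 * (y ^ 8)⁻¹ := by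
      calc _ ≤ y ^ 8 * (36 * (y ^ 16)⁻¹) :=
            mul_le_mul hN hlog (by positivity) (by positivity)
        _ = 36 * (y ^ 8)⁻¹ := by rw [← hinv]; ring
    have h2 : (⌊y ^ 8⌋₊ : ℝ) * (Real.exp (-(16 * Real.log y)) + 2 * RankCoupling.upProb q L)
        ≤ (1 + 2 * (q : ℝ) ^ 2) * (y ^ 8)⁻¹ := by
      rw [hexp]
      have h0 := RankCoupling.upProb_nonneg hq2 L
      calc _ ≤ y ^ 8 * ((y ^ 16)⁻¹ + 2 * ((q : ℝ) ^ 2 * (y ^ 16)⁻¹)) :=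
            mul_le_mul hN (by linarith) (by positivity) (by positivity)
        _ = (1 + 2 * (q : ℝ) ^ 2) * (y ^ 8)⁻¹ := by rw [← hinv]; ring
    have h3 : C * (y ^ 8)⁻¹ = 36 * (y ^ 8)⁻¹ + (1 + 2 * (q : ℝ) ^ 2) * (y ^ 8)⁻¹
        + 24 * Real.exp 34 * (y ^ 8)⁻¹ := by rw [hC]; ring
    rw [Real.coe_toNNReal _ (by positivity)]
    linarith
  · obtain ⟨h1, h2⟩ := hgood ω hω
    refine ⟨fun i hi => ?_, ?_⟩
    · obtain ⟨j1, j2, j3, j4⟩ := h1 i (Nat.le_floor hi)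
      refine ⟨j1, j2, j3, j4.trans ?_⟩
      have hδ : RankCoupling.stepSize q m ≤ (y ^ 25)⁻¹ := by
        rw [RankCoupling.stepSize, ← hpow 25 0.5 (by norm_num), ← Real.rpow_neg hq0.le,
          ← Real.rpow_intCast, show -(0.5 * (n : ℝ)) = ((-(m : ℤ) : ℤ) : ℝ) by
            push_cast; rw [hnm']; ring]
        exact div_le_self (by positivity) (by linarith)
      have hy21 : y ^ 4 ≤ y ^ 17 := pow_le_pow_right₀ hy1 (by norm_num)
      calc (i : ℝ) * RankCoupling.stepSize q m ≤ y ^ 8 * (y ^ 25)⁻¹ :=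
            mul_le_mul hi hδ (RankCoupling.stepSize_pos hq2 m).le (by positivity)
        _ = (y ^ 17)⁻¹ := by field_simp
        _ ≤ (y ^ 4)⁻¹ := inv_anti₀ (by positivity) hy21
    · exact h2
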